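/- Let $N\ge 2$, $1<p<N$, and let $\Omega\subset\mathbb R^N$ be open and bounded. Let $a:\Omega\times\mathbb R\times\mathbb R^N\to\mathbb R^N$ be a Carathéodory function such that $$a(x,s,\xi)\cdot\xi\ \ge\ b(s)|\xi|^p\qquad\text{for a.e. }x\in\Omega\text{ and all }s\in\mathbb R,\ \xi\in\mathbb R^N,$$ where $b:\mathbb R\to\mathbb R$ is continuous and bounded and, for some $\alpha>0$ and $\gamma_2\ge 0$, $$b(s)\ \ge\ \frac{\alpha}{(1+|s|)^{\theta(p-1)}}\quad\text{for all }s\in\mathbb R,\qquad \theta=1+\frac{\gamma_2}{p-1}.$$ Let $h:[0,\infty)\to[0,\infty]$ be continuous and finite outside the origin and such that, for some $c_2,s_2>0$, $h(s)\le c_2 s^{-\gamma_2}$ for all $s\ge s_2$. Let $f\in L^{N/p}(\Omega)$ be nonnegative. For $k>0$ put $T_k(s)=\max(-k,\min(s,k))$. If $u$ is measurable and $T_k(u)\in W^{1,1}_{\rm loc}(\Omega)$ for every $k>0$, then $\nabla u$ denotes the a.e. unique measurable $v:\Omega\to\mathbb R^N$ with $\nabla T_k(u)=v\chi_{\{|u|\le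 k\}}$ a.e. in $\Omega$ for every $k>0$. A nonnegative, measurable, a.e. finite function $u$ on $\Omega$ is called an entropy solution of $$-\operatorname{div}(a(x,u,\nabla u))=h(u)f\ \text{ in }\Omega,\qquad u\ge 0\ \text{ in }\Omega,\qquad u=0\ \text{ on }\partial\Omega,$$ if $T_k(u)\in W^{1,p}_0(\Omega)$ for every $k>0$, and if for every $k>0$ and every $\varphi\in W^{1,p}_0(\Omega)\cap L^\infty(\Omega)$ one has $a(x,T_k(u),\nabla T_k(u))\in L^{\frac p{p-1}}(\Omega)^N$, $h(u)fT_k(u-\varphi)\in L^1(\Omega)$ (with $\infty\cdot 0=0$) and $$\int_\Omega a(x,u,\nabla u)\cdot\nabla T_k(u-\varphi)\ \le\ \int_\Omega h(u)fT_k(u-\varphi).$$ Then every entropy solution $u$ of this problem belongs to $W^{1,p}_0(\Omega)$ and to $L^q(\Omega)$ for every $q<\infty$. -/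

import Mathlib

open MeasureTheory Filter Topology
open scoped ENNReal ContDiff

namespace EntropyDirichlet

/-- The Euclidean space `ℝ^N`. -/
abbrev E (N : ℕ) : Type := EuclideanSpace ℝ (Fin N)

/-- The truncation `T_k(s) = max (-k) (min s k)`. -/
noncomputable def trunc (k s : ℝ) : ℝ := max (-k) (min s k)

/-- `ψ ∈ C_c^∞(Ω)`. -/
def IsTestFunction {N : ℕ} (Ω : Set (E N)) (ψ : E N → ℝ) : Prop :=
  ContDiff ℝ ∞ ψ ∧ HasCompactSupport ψ ∧ tsupport ψ ⊆ Ω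

/-- `w ∈ L¹_loc(Ω)` has the distributional gradient `G ∈ L¹_loc(Ω)^N` on `Ω`
(so `w ∈ W^{1,1}_loc(Ω)` and `G = ∇w`, which is unique up to null sets). -/
def IsWeakGradient {N : ℕ} (Ω : Set (E N)) (w : E N → ℝ) (G : E N → E N) : Prop :=
  LocallyIntegrableOn w Ω ∧ LocallyIntegrableOn G Ω ∧
    ∀ ψ : E N → ℝ, IsTestFunction Ω ψ → ∀ e : E N,
      ∫ x in Ω, w x * fderiv ℝ ψ x e = -∫ x in Ω, inner ℝ (G x) e * ψ x

/-- `w ∈ W^{1,p}_0(Ω)`, the closure of `C_c^∞(Ω)` in `W^{1,p}(Ω)`: the function `w` and its weak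
gradient `G` are in `L^p(Ω)`, and some sequence of test functions converges to `w` in `L^p(Ω)`
with gradients converging to `G` in `L^p(Ω)`. -/
def MemW0 {N : ℕ} (p : ℝ) (Ω : Set (E N)) (w : E N → ℝ) : Prop :=
  MemLp w (ENNReal.ofReal p) (volume.restrict Ω) ∧
    ∃ G : E N → E N, IsWeakGradient Ω w G ∧
      MemLp G (ENNReal.ofReal p) (volume.restrict Ω) ∧
      ∃ ψ : ℕ → E N → ℝ, (∀ n, IsTestFunction Ω (ψ n)) ∧
        Tendsto (fun n => eLpNorm (fun x => ψ n x - w x) (ENNReal.ofReal p)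
          (volume.restrict Ω)) atTop (𝓝 0) ∧
        Tendsto (fun n => eLpNorm (fun x => gradient (ψ n) x - G x) (ENNReal.ofReal p)
          (volume.restrict Ω)) atTop (𝓝 0)

/-- `v` is the generalized gradient of `u`: it is the (up to null sets unique) measurable function
with `∇ T_k(u) = v χ_{|u| ≤ k}` almost everywhere in `Ω` for every `k > 0`. -/
def IsGenGradient {N : ℕ} (Ω : Set (E N)) (u : E N → ℝ) (v : E N → E N) : Prop :=
  AEMeasurable v (volume.restrict Ω) ∧
    ∀ k : ℝ, 0 < k →
      IsWeakGradient Ω (fun x => trunc k (u x)) ({x | |u x| ≤ k}.indicator v)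

/-- `a : Ω × ℝ × ℝ^N → ℝ^N` is a Carathéodory function. -/
def IsCaratheodory {N : ℕ} (Ω : Set (E N)) (a : E N → ℝ → E N → E N) : Prop :=
  (∀ s ξ, AEMeasurable (fun x => a x s ξ) (volume.restrict Ω)) ∧
    ∀ᵐ x ∂volume.restrict Ω, Continuous fun z : ℝ × E N => a x z.1 z.2

/-- The factor `h(u) f` with values in `[0, ∞]` (with the convention `∞ · 0 = 0`), where `f ≥ 0`
and `h` may be infinite at the origin. -/
noncomputable def source {N : ℕ} (h : ℝ → ℝ≥0∞) (f u : E N → ℝ) (x : E N) : ℝ≥0∞ :=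
  h (u x) * ENNReal.ofReal (f x)

/-- `u` is an entropy solution of `-div a(x, u, ∇u) = h(u) f` in `Ω`, `u ≥ 0` in `Ω`, `u = 0` on
`∂Ω`. Here `v` is the generalized gradient of `u`, and `G` is the weak gradient of the truncation
in question; both are determined up to null sets. -/
structure IsEntropySolution {N : ℕ} (p : ℝ) (Ω : Set (E N)) (a : E N → ℝ → E N → E N)
    (h : ℝ → ℝ≥0∞) (f u : E N → ℝ) : Prop where
  aemeasurable : AEMeasurable u (volume.restrict Ω)
  nonneg : ∀ᵐ x ∂volume.restrict Ω, 0 ≤ u x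
  trunc_mem : ∀ k : ℝ, 0 < k → MemW0 p Ω (fun x => trunc k (u x))
  /-- `a(x, T_k(u), ∇T_k(u)) ∈ L^{p/(p-1)}(Ω)^N`. -/
  flux_memLp : ∀ k : ℝ, 0 < k → ∀ G : E N → E N,
    IsWeakGradient Ω (fun x => trunc k (u x)) G →
      MemLp (fun x => a x (trunc k (u x)) (G x)) (ENNReal.ofReal (p / (p - 1)))
        (volume.restrict Ω)
  /-- `h(u) f T_k(u - φ) ∈ L¹(Ω)`. -/
  source_integrable : ∀ k : ℝ, 0 < k → ∀ φ : E N → ℝ,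
    MemW0 p Ω φ → MemLp φ ⊤ (volume.restrict Ω) →
      ∫⁻ x in Ω, source h f u x * ‖trunc k (u x - φ x)‖ₑ < ⊤
  /-- `∫ a(x, u, ∇u) · ∇T_k(u - φ) ≤ ∫ h(u) f T_k(u - φ)`. -/
  entropy_le : ∀ v : E N → E N, IsGenGradient Ω u v →
    ∀ k : ℝ, 0 < k → ∀ φ : E N → ℝ,
      MemW0 p Ω φ → MemLp φ ⊤ (volume.restrict Ω) →
        ∀ G : E N → E N, IsWeakGradient Ω (fun x => trunc k (u x - φ x)) G →
          ∫ x in Ω, inner ℝ (a x (u x) (v x)) (G x) ≤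
            ∫ x in Ω, (source h f u x).toReal * trunc k (u x - φ x)

end EntropyDirichlet

/-! Testing the entropy inequality with `φ = T_t(u)` and `k = t` isolates the slice `{t < u ≤ 2t}`,
since `T_t(u - T_t(u)) = T_{2t}(u) - T_t(u)`. For large `t`, coercivity there costs a factor of
order `t^(p-1+γ₂)`, while the source contributes at most `c₂ t^(-γ₂) · t · ∫_{u>t} f`. The powers of
`γ₂` cancel, and the energy of the slice is at most `K t^p ∫_{u>t} f`
(`IsEntropySolution.lintegral_slice_le`).

The slice function equals `t` on `{u > 2t}`, so the Sobolev inequality bounds `t^p |{u >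
2t}|^(p/p*)` by this energy (`rpow_mul_measure_le`), and Hölder bounds `∫_{u>t} f` by
`‖f‖_{L^{N/p}(u>t)} |{u > t}|^(1-p/N)`. Because `p/p* = 1 - p/N`, both measures carry the same
power, and `t^p` cancels: `|{u > 2t}|^κ ≤ C ‖f‖_{L^{N/p}(u>t)} |{u > t}|^κ`. The factor tends to
zero as `t → ∞`, so along dyadic levels the measures decay faster than every geometric sequence
(`tsum_pow_mul_lt_top`). This gives all moments of `u`; summing the slice energies gives `∇u ∈ L^p`,
and the truncations then converge to `u` in `W^{1,p}_0(Ω)`.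

The rest is Sobolev calculus drawn from the definition by test functions: uniqueness of weak
gradients, a chain rule, truncation, closedness, and the gluing of the gradients of the truncations
into one field. -/

namespace EntropyDirichlet

/-! ### Convergence in `L^p` and `L^1` -/

section Convergence

variable {X F : Type*} [MeasurableSpace X] {μ : Measure X} [NormedAddCommGroup F]

/-- Dominated convergence to zero in `L^p`. -/
lemma tendsto_eLpNorm_zero_of_dominated {p : ℝ} (hp : 0 < p) {f : ℕ → X → F} {g : X → ℝ}
    (hf : ∀ n, AEStronglyMeasurable (f n) μ) (hg : MemLp g (ENNReal.ofReal p) μ)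
    (hfg : ∀ n, ∀ᵐ x ∂μ, ‖f n x‖ ≤ g x)
    (hlim : ∀ᵐ x ∂μ, Tendsto (fun n => f n x) atTop (𝓝 0)) :
    Tendsto (fun n => eLpNorm (f n) (ENNReal.ofReal p) μ) atTop (𝓝 0) := by
  have h0 : ENNReal.ofReal p ≠ 0 := by simpa using hp
  simp only [eLpNorm_eq_lintegral_rpow_enorm_toReal h0 ENNReal.ofReal_ne_top,
    ENNReal.toReal_ofReal hp.le]
  have key : Tendsto (fun n => ∫⁻ x, ‖f n x‖ₑ ^ p ∂μ) atTop (𝓝 (∫⁻ _, 0 ∂μ)) := by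
    refine tendsto_lintegral_of_dominated_convergence' (fun x => ‖g x‖ₑ ^ p)
      (fun n => (hf n).enorm.pow_const p) (fun n => ?_) ?_ ?_
    · filter_upwards [hfg n] with x hx
      gcongr
      exact enorm_le_iff_norm_le.2 (hx.trans (le_abs_self _))
    · have := lintegral_rpow_enorm_lt_top_of_eLpNorm_lt_top h0 ENNReal.ofReal_ne_top hg.2
      rw [ENNReal.toReal_ofReal hp.le] at this
      exact this.ne
    · filter_upwards [hlim] with x hx
      have := (ENNReal.continuous_rpow_const (y := p)).tendsto 0 |>.comp
        ((continuous_enorm.tendsto (0 : F)).comp hx |>.trans (by simp))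
      simpa [hp, Function.comp_def] using this
  have := (ENNReal.continuous_rpow_const (y := 1 / p)).tendsto _ |>.comp key
  simpa [hp, Function.comp_def] using this

lemma tendsto_eLpNorm_one [IsFiniteMeasure μ] {p : ℝ} (hp : 1 ≤ p) {f : ℕ → X → F}
    (hf : ∀ n, AEStronglyMeasurable (f n) μ)
    (hlim : Tendsto (fun n => eLpNorm (f n) (ENNReal.ofReal p) μ) atTop (𝓝 0)) :
    Tendsto (fun n => eLpNorm (f n) 1 μ) atTop (𝓝 0) := by
  have hp' : (1 : ℝ≥0∞) ≤ ENNReal.ofReal p := by simpa using ENNReal.ofReal_le_ofReal hp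
  have h2 : μ Set.univ ^ (1 / (1 : ℝ≥0∞).toReal - 1 / (ENNReal.ofReal p).toReal) ≠ ⊤ := by
    refine ENNReal.rpow_ne_top_of_nonneg ?_ (measure_ne_top μ _)
    rw [ENNReal.toReal_ofReal (by linarith)]
    simpa using inv_le_one_of_one_le₀ hp
  refine tendsto_of_tendsto_of_tendsto_of_le_of_le tendsto_const_nhds ?_
    (fun n => zero_le) (fun n => eLpNorm_le_eLpNorm_mul_rpow_measure_univ hp' (hf n))
  simpa using ENNReal.Tendsto.mul_const hlim (Or.inr h2)

lemma tendsto_integral_mul_of_tendsto_L1 {w : X → ℝ} {f : ℕ → X → ℝ} {g : X → ℝ} {C : ℝ}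
    (hw : Integrable w μ) (hf : ∀ n, Integrable (f n) μ) (hg : AEStronglyMeasurable g μ)
    (hC : ∀ x, ‖g x‖ ≤ C)
    (hlim : Tendsto (fun n => eLpNorm (fun x => f n x - w x) 1 μ) atTop (𝓝 0)) :
    Tendsto (fun n => ∫ x, f n x * g x ∂μ) atTop (𝓝 (∫ x, w x * g x ∂μ)) := by
  refine tendsto_integral_of_L1' _ (hw.aestronglyMeasurable.mul hg)
    (Eventually.of_forall fun n => (hf n).mul_bdd hg (Eventually.of_forall hC)) ?_
  refine tendsto_of_tendsto_of_tendsto_of_le_of_le tendsto_const_nhds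
    (h := fun n => ENNReal.ofReal C * eLpNorm (fun x => f n x - w x) 1 μ) ?_
    (fun n => zero_le) (fun n => ?_)
  · simpa using ENNReal.Tendsto.const_mul hlim (Or.inr ENNReal.ofReal_ne_top)
  · refine eLpNorm_le_mul_eLpNorm_of_ae_le_mul (Eventually.of_forall fun x => ?_) 1
    have : (f n x * g x - w x * g x) = (f n x - w x) * g x := by ring
    rw [Pi.sub_apply, Pi.mul_apply, this, norm_mul, mul_comm]
    gcongr
    exact hC x

end Convergence

/-! ### Test functions and weak gradients -/

variable {N : ℕ} {Ω : Set (E N)}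

namespace IsTestFunction

variable {ψ : E N → ℝ}

lemma continuous_fderiv_apply (hψ : IsTestFunction Ω ψ) (e : E N) :
    Continuous fun x => fderiv ℝ ψ x e :=
  (hψ.1.continuous_fderiv (by simp)).clm_apply continuous_const

lemma integrable_mul {g : E N → ℝ} {η : E N → ℝ} (hψ : IsTestFunction Ω ψ)
    (hg : LocallyIntegrableOn g Ω) (hη : Continuous η) (hs : tsupport η ⊆ tsupport ψ) :
    Integrable (fun x => g x * η x) (volume.restrict Ω) := by
  have hK : IsCompact (tsupport ψ) := hψ.2.1
  have h1 : IntegrableOn g (tsupport ψ) := hg.integrableOn_compact_subset hψ.2.2 hK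
  have h2 := h1.mul_continuousOn hη.continuousOn hK
  refine Integrable.restrict ?_
  rw [← integrableOn_iff_integrable_of_support_subset (s := tsupport ψ)]
  · exact h2
  · intro x hx
    exact hs (subset_tsupport _ (right_ne_zero_of_mul hx))

lemma integrable_mul_self {g : E N → ℝ} (hψ : IsTestFunction Ω ψ)
    (hg : LocallyIntegrableOn g Ω) :
    Integrable (fun x => g x * ψ x) (volume.restrict Ω) :=
  hψ.integrable_mul hg hψ.1.continuous subset_rfl

lemma integrable_mul_fderiv {g : E N → ℝ} (hψ : IsTestFunction Ω ψ)
    (hg : LocallyIntegrableOn g Ω) (e : E N) :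
    Integrable (fun x => g x * fderiv ℝ ψ x e) (volume.restrict Ω) :=
  hψ.integrable_mul hg (hψ.continuous_fderiv_apply e) (tsupport_fderiv_apply_subset ℝ e)

lemma exists_bound (hψ : IsTestFunction Ω ψ) : ∃ C, ∀ x, ‖ψ x‖ ≤ C :=
  hψ.1.continuous.bounded_above_of_compact_support hψ.2.1

lemma exists_bound_fderiv (hψ : IsTestFunction Ω ψ) (e : E N) :
    ∃ C, ∀ x, ‖fderiv ℝ ψ x e‖ ≤ C :=
  (hψ.continuous_fderiv_apply e).bounded_above_of_compact_support
    (hψ.2.1.fderiv_apply ℝ e)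

lemma gradient_continuous (hψ : IsTestFunction Ω ψ) : Continuous (gradient ψ) :=
  (InnerProductSpace.toDual ℝ (E N)).symm.continuous.comp (hψ.1.continuous_fderiv (by simp))

lemma sub {φ : E N → ℝ} (hψ : IsTestFunction Ω ψ) (hφ : IsTestFunction Ω φ) :
    IsTestFunction Ω (fun x => ψ x - φ x) := by
  refine ⟨hψ.1.sub hφ.1, hψ.2.1.sub hφ.2.1, ?_⟩
  exact (tsupport_sub _ _).trans (Set.union_subset hψ.2.2 hφ.2.2)

end IsTestFunction

lemma locallyIntegrableOn_inner {G : E N → E N} (hG : LocallyIntegrableOn G Ω) (e : E N) :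
    LocallyIntegrableOn (fun x => inner ℝ (G x) e) Ω := fun x hx => by
  obtain ⟨s, hs, h⟩ := hG x hx
  exact ⟨s, hs, h.inner_const e⟩

namespace IsWeakGradient

variable {w w' : E N → ℝ} {G G' : E N → E N}

/-- Each coordinate of `G - G'` annihilates all test functions, so the fundamental lemma of the
calculus of variations applies coordinatewise. -/
lemma unique (hΩ : IsOpen Ω) (h : IsWeakGradient Ω w G) (h' : IsWeakGradient Ω w G') :
    G =ᵐ[volume.restrict Ω] G' := by
  have key : ∀ i : Fin N, ∀ᵐ x, x ∈ Ω → (G x - G' x) i = 0 := by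
    intro i
    set e : E N := EuclideanSpace.single i (1 : ℝ)
    have hi : ∀ x, inner ℝ (G x) e - inner ℝ (G' x) e = (G x - G' x) i := fun x => by
      simp [e, EuclideanSpace.inner_single_right]
    have hl := locallyIntegrableOn_inner h.2.1 e
    have hl' := locallyIntegrableOn_inner h'.2.1 e
    have := hΩ.ae_eq_zero_of_integral_contDiff_smul_eq_zero (hl.sub hl') (fun ψ h1 h2 h3 => ?_)
    · filter_upwards [this] with x hx hxΩ
      rw [← hi]
      exact hx hxΩ
    · have hψ : IsTestFunction Ω ψ := ⟨h1, h2, h3⟩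
      have e1 : ∫ x, ψ x • ((fun x => inner ℝ (G x) e) - fun x => inner ℝ (G' x) e) x
          = ∫ x in Ω, (inner ℝ (G x) e * ψ x - inner ℝ (G' x) e * ψ x) := by
        rw [setIntegral_eq_integral_of_forall_compl_eq_zero]
        · congr 1; ext x; simp only [Pi.sub_apply, smul_eq_mul]; ring
        · intro x hx
          have : ψ x = 0 := image_eq_zero_of_notMem_tsupport fun hx' => hx (h3 hx')
          simp [this]
      rw [e1, integral_sub (hψ.integrable_mul_self hl) (hψ.integrable_mul_self hl')]
      have := h.2.2 ψ hψ e
      have := h'.2.2 ψ hψ e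
      linarith
  rw [EventuallyEq, ae_restrict_iff' hΩ.measurableSet]
  filter_upwards [ae_all_iff.2 key] with x hx hxΩ
  rw [← sub_eq_zero]
  ext i
  exact hx i hxΩ

lemma sub (h : IsWeakGradient Ω w G) (h' : IsWeakGradient Ω w' G') :
    IsWeakGradient Ω (fun x => w x - w' x) (fun x => G x - G' x) := by
  refine ⟨h.1.sub h'.1, h.2.1.sub h'.2.1, fun ψ hψ e => ?_⟩
  have e1 := h.2.2 ψ hψ e
  have e2 := h'.2.2 ψ hψ e
  simp only [sub_mul, inner_sub_left]
  rw [integral_sub (hψ.integrable_mul_fderiv h.1 e) (hψ.integrable_mul_fderiv h'.1 e),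
    integral_sub (hψ.integrable_mul_self (locallyIntegrableOn_inner h.2.1 e))
      (hψ.integrable_mul_self (locallyIntegrableOn_inner h'.2.1 e))]
  linarith

lemma congr (h : IsWeakGradient Ω w G) (hw : w =ᵐ[volume.restrict Ω] w')
    (hG : G =ᵐ[volume.restrict Ω] G') : IsWeakGradient Ω w' G' := by
  refine ⟨(locallyIntegrableOn_congr hw).1 h.1, (locallyIntegrableOn_congr hG).1 h.2.1,
    fun ψ hψ e => ?_⟩
  have e1 := h.2.2 ψ hψ e
  have e2 : ∫ x in Ω, w x * fderiv ℝ ψ x e = ∫ x in Ω, w' x * fderiv ℝ ψ x e :=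
    integral_congr_ae (by filter_upwards [hw] with x hx using by simp only [hx])
  have e3 : ∫ x in Ω, inner ℝ (G x) e * ψ x = ∫ x in Ω, inner ℝ (G' x) e * ψ x :=
    integral_congr_ae (by filter_upwards [hG] with x hx using by simp only [hx])
  rw [← e2, ← e3, e1]

/-- Both sides of the integration by parts formula pair the function or its gradient with a fixed
bounded factor, so `L^1` convergence is enough to pass to the limit. -/
lemma of_tendsto {wn : ℕ → E N → ℝ} {Gn : ℕ → E N → E N}
    (hw : Integrable w (volume.restrict Ω)) (hG : Integrable G (volume.restrict Ω))
    (hwn : ∀ n, Integrable (wn n) (volume.restrict Ω))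
    (hGn : ∀ n, Integrable (Gn n) (volume.restrict Ω))
    (h : ∀ n, IsWeakGradient Ω (wn n) (Gn n))
    (hlim : Tendsto (fun n => eLpNorm (fun x => wn n x - w x) 1 (volume.restrict Ω))
      atTop (𝓝 0))
    (hlim' : Tendsto (fun n => eLpNorm (fun x => Gn n x - G x) 1 (volume.restrict Ω))
      atTop (𝓝 0)) :
    IsWeakGradient Ω w G := by
  refine ⟨IntegrableOn.locallyIntegrableOn hw, IntegrableOn.locallyIntegrableOn hG,
    fun ψ hψ e => ?_⟩
  obtain ⟨C, hC⟩ := hψ.exists_bound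
  obtain ⟨C', hC'⟩ := hψ.exists_bound_fderiv e
  have h1 := tendsto_integral_mul_of_tendsto_L1 hw hwn
    (hψ.continuous_fderiv_apply e).aestronglyMeasurable hC' hlim
  have h2 := tendsto_integral_mul_of_tendsto_L1 (f := fun n x => inner ℝ (Gn n x) e)
    (hG.inner_const e) (fun n => (hGn n).inner_const e)
    hψ.1.continuous.aestronglyMeasurable hC ?_
  · have h3 : (fun n => ∫ x in Ω, wn n x * fderiv ℝ ψ x e) =
        fun n => -∫ x in Ω, inner ℝ (Gn n x) e * ψ x := funext fun n => (h n).2.2 ψ hψ e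
    rw [h3] at h1
    exact tendsto_nhds_unique h1 h2.neg
  · refine tendsto_of_tendsto_of_tendsto_of_le_of_le tendsto_const_nhds
      (h := fun n => ENNReal.ofReal ‖e‖ * eLpNorm (fun x => Gn n x - G x) 1 (volume.restrict Ω))
      ?_ (fun n => zero_le) (fun n => ?_)
    · simpa using ENNReal.Tendsto.const_mul (a := ENNReal.ofReal ‖e‖) hlim'
        (Or.inr ENNReal.ofReal_ne_top)
    · refine eLpNorm_le_mul_eLpNorm_of_ae_le_mul (Eventually.of_forall fun x => ?_) 1
      rw [← inner_sub_left, mul_comm]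
      exact norm_inner_le_norm _ _

/-- The classical chain rule, on a test function. -/
lemma comp_testFunction {ψ : E N → ℝ} (hψ : IsTestFunction Ω ψ) {F F' : ℝ → ℝ}
    (hF : ∀ t, HasDerivAt F (F' t) t) (hF' : Continuous F') :
    IsWeakGradient Ω (fun x => F (ψ x)) (fun x => F' (ψ x) • gradient ψ x) := by
  have hFc : Continuous F := continuous_iff_continuousAt.2 fun t => (hF t).continuousAt
  have hc1 : Continuous fun x => F (ψ x) := hFc.comp hψ.1.continuous
  have hc2 : Continuous fun x => F' (ψ x) • gradient ψ x :=
    (hF'.comp hψ.1.continuous).smul hψ.gradient_continuous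
  have hl1 : LocallyIntegrable (fun x => F (ψ x)) := hc1.locallyIntegrable
  have hl2 : LocallyIntegrable (fun x => F' (ψ x) • gradient ψ x) := hc2.locallyIntegrable
  refine ⟨hl1.locallyIntegrableOn _, hl2.locallyIntegrableOn _, fun φ hφ e => ?_⟩
  have hder : ∀ x, HasFDerivAt (fun x => F (ψ x)) (F' (ψ x) • fderiv ℝ ψ x) x := fun x =>
    (hF (ψ x)).comp_hasFDerivAt x ((hψ.1.differentiable (by simp)) x).hasFDerivAt
  have hfd : ∀ x, inner ℝ (F' (ψ x) • gradient ψ x) e = fderiv ℝ (fun x => F (ψ x)) x e := by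
    intro x
    rw [(hder x).fderiv, inner_smul_left, inner_gradient_left]
    simp
  have hφ' : IsTestFunction Set.univ φ := ⟨hφ.1, hφ.2.1, Set.subset_univ _⟩
  have hfc : Continuous fun x => fderiv ℝ (fun x => F (ψ x)) x e := by
    simp_rw [← hfd]
    exact hc2.inner continuous_const
  -- Both integrands vanish off `Ω` together with `φ`, so this is integration by parts on the whole
  -- space, where `F ∘ ψ` is differentiable everywhere.
  rw [setIntegral_eq_integral_of_forall_compl_eq_zero,
    setIntegral_eq_integral_of_forall_compl_eq_zero]
  · simp only [hfd]
    refine integral_mul_fderiv_eq_neg_fderiv_mul_of_integrable ?_ ?_ ?_ ?_ ?_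
    · simpa using hφ'.integrable_mul_self (hfc.locallyIntegrable.locallyIntegrableOn _)
    · simpa using hφ'.integrable_mul_fderiv (hl1.locallyIntegrableOn _) e
    · simpa using hφ'.integrable_mul_self (hl1.locallyIntegrableOn _)
    · exact fun x _ => (hder x).differentiableAt
    · exact fun x _ => (hφ.1.differentiable (by simp)) x
  · intro x hx
    have : φ x = 0 := image_eq_zero_of_notMem_tsupport fun hx' => hx (hφ.2.2 hx')
    simp [this]
  · intro x hx
    have : fderiv ℝ φ x e = 0 := image_eq_zero_of_notMem_tsupport (f := fun x => fderiv ℝ φ x e)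
      fun hx' => hx (hφ.2.2 (tsupport_fderiv_apply_subset ℝ e hx'))
    simp [this]

end IsWeakGradient

lemma norm_gradient (ψ : E N → ℝ) (x : E N) : ‖gradient ψ x‖ = ‖fderiv ℝ ψ x‖ :=
  (InnerProductSpace.toDual ℝ (E N)).symm.norm_map _

lemma IsTestFunction.integrable_gradient {ψ : E N → ℝ} (hψ : IsTestFunction Ω ψ) :
    Integrable (gradient ψ) := by
  refine hψ.gradient_continuous.integrable_of_hasCompactSupport ?_
  exact (hψ.2.1.fderiv ℝ).comp_left
    (g := (InnerProductSpace.toDual ℝ (E N)).symm) (map_zero _)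

lemma IsTestFunction.support_gradient_subset {ψ : E N → ℝ} (hψ : IsTestFunction Ω ψ) :
    Function.support (gradient ψ) ⊆ Ω := by
  intro x hx
  refine hψ.2.2 (support_fderiv_subset ℝ ?_)
  rw [Function.mem_support, ← norm_ne_zero_iff] at hx ⊢
  rwa [← norm_gradient]

/-! ### `W^{1,p}_0(Ω)` and the chain rule -/

/-- `w ∈ W^{1,p}_0(Ω)` with weak gradient `G`. -/
def MemW0With (p : ℝ) (Ω : Set (E N)) (w : E N → ℝ) (G : E N → E N) : Prop :=
  MemLp w (ENNReal.ofReal p) (volume.restrict Ω) ∧ IsWeakGradient Ω w G ∧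
      MemLp G (ENNReal.ofReal p) (volume.restrict Ω) ∧
      ∃ ψ : ℕ → E N → ℝ, (∀ n, IsTestFunction Ω (ψ n)) ∧
        Tendsto (fun n => eLpNorm (fun x => ψ n x - w x) (ENNReal.ofReal p)
          (volume.restrict Ω)) atTop (𝓝 0) ∧
        Tendsto (fun n => eLpNorm (fun x => gradient (ψ n) x - G x) (ENNReal.ofReal p)
          (volume.restrict Ω)) atTop (𝓝 0)

lemma memW0_iff {p : ℝ} {w : E N → ℝ} : MemW0 p Ω w ↔ ∃ G, MemW0With p Ω w G :=
  ⟨fun ⟨h, G, hG⟩ => ⟨G, h, hG⟩, fun ⟨G, h, hG⟩ => ⟨h, G, hG⟩⟩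

lemma abs_sub_le_of_hasDerivAt {F F' : ℝ → ℝ} (hF : ∀ t, HasDerivAt F (F' t) t) {C : ℝ}
    (hC : ∀ t, ‖F' t‖ ≤ C) (s t : ℝ) : ‖F t - F s‖ ≤ C * ‖t - s‖ :=
  Convex.norm_image_sub_le_of_norm_hasDerivWithin_le (s := Set.univ)
    (fun x _ => (hF x).hasDerivWithinAt) (fun x _ => hC x) convex_univ (Set.mem_univ _)
    (Set.mem_univ _)

namespace MemW0With

variable {p : ℝ} {w w' : E N → ℝ} {G G' : E N → E N}

lemma congr (h : MemW0With p Ω w G) (hw : w =ᵐ[volume.restrict Ω] w')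
    (hG : G =ᵐ[volume.restrict Ω] G') : MemW0With p Ω w' G' := by
  obtain ⟨h1, h2, h3, ψ, hψ, hl, hl'⟩ := h
  refine ⟨h1.ae_eq hw, h2.congr hw hG, h3.ae_eq hG, ψ, hψ, ?_, ?_⟩
  · refine hl.congr fun n => eLpNorm_congr_ae ?_
    filter_upwards [hw] with x hx using by rw [hx]
  · refine hl'.congr fun n => eLpNorm_congr_ae ?_
    filter_upwards [hG] with x hx using by rw [hx]

lemma sub (hp : 1 ≤ p) (h : MemW0With p Ω w G) (h' : MemW0With p Ω w' G') :
    MemW0With p Ω (fun x => w x - w' x) (fun x => G x - G' x) := by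
  obtain ⟨h1, h2, h3, ψ, hψ, hl, hl'⟩ := h
  obtain ⟨h1', h2', h3', φ, hφ, hm, hm'⟩ := h'
  have hp' : (1 : ℝ≥0∞) ≤ ENNReal.ofReal p := by simpa using ENNReal.ofReal_le_ofReal hp
  refine ⟨h1.sub h1', h2.sub h2', h3.sub h3', fun n x => ψ n x - φ n x,
    fun n => (hψ n).sub (hφ n), ?_, ?_⟩
  · have := hl.add hm
    rw [add_zero] at this
    refine tendsto_of_tendsto_of_tendsto_of_le_of_le tendsto_const_nhds this
      (fun n => zero_le) (fun n => ?_)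
    refine le_trans (le_of_eq ?_) (eLpNorm_sub_le (f := fun x => ψ n x - w x)
      (g := fun x => φ n x - w' x)
      ((hψ n).1.continuous.aestronglyMeasurable.sub h1.1)
      ((hφ n).1.continuous.aestronglyMeasurable.sub h1'.1) hp')
    congr 1
    ext x
    simp only [Pi.sub_apply]
    ring
  · have := hl'.add hm'
    rw [add_zero] at this
    refine tendsto_of_tendsto_of_tendsto_of_le_of_le tendsto_const_nhds this
      (fun n => zero_le) (fun n => ?_)
    refine le_trans (le_of_eq ?_) (eLpNorm_sub_le (f := fun x => gradient (ψ n) x - G x)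
      (g := fun x => gradient (φ n) x - G' x)
      ((hψ n).gradient_continuous.aestronglyMeasurable.sub h3.1)
      ((hφ n).gradient_continuous.aestronglyMeasurable.sub h3'.1) hp')
    congr 1
    ext1 x
    have : gradient (fun x => ψ n x - φ n x) x = gradient (ψ n) x - gradient (φ n) x := by
      simp only [gradient]
      rw [fderiv_fun_sub ((hψ n).1.differentiable (by simp) x)
        ((hφ n).1.differentiable (by simp) x), map_sub]
    simp only [Pi.sub_apply, this]
    abel

/-- The approximating test functions may be taken to converge almost everywhere. -/
lemma exists_approx (hp : 1 ≤ p) (h : MemW0With p Ω w G) :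
    ∃ ψ : ℕ → E N → ℝ, (∀ n, IsTestFunction Ω (ψ n)) ∧
        Tendsto (fun n => eLpNorm (fun x => ψ n x - w x) (ENNReal.ofReal p)
          (volume.restrict Ω)) atTop (𝓝 0) ∧
        Tendsto (fun n => eLpNorm (fun x => gradient (ψ n) x - G x) (ENNReal.ofReal p)
          (volume.restrict Ω)) atTop (𝓝 0) ∧
        ∀ᵐ x ∂volume.restrict Ω, Tendsto (fun n => ψ n x) atTop (𝓝 (w x)) := by
  obtain ⟨h1, h2, h3, ψ, hψ, hl, hl'⟩ := h
  have hp0 : ENNReal.ofReal p ≠ 0 := by simpa using (by linarith : (0 : ℝ) < p)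
  obtain ⟨ns, hns, hae⟩ := (tendstoInMeasure_of_tendsto_eLpNorm hp0
    (fun n => (hψ n).1.continuous.aestronglyMeasurable) h1.1 hl).exists_seq_tendsto_ae
  exact ⟨fun n => ψ (ns n), fun n => hψ _, hl.comp hns.tendsto_atTop,
    hl'.comp hns.tendsto_atTop, hae⟩

/-- The chain rule for a `C¹` function with bounded derivative. -/
lemma isWeakGradient_comp [IsFiniteMeasure (volume.restrict Ω)] (hp : 1 ≤ p)
    (h : MemW0With p Ω w G) {F F' : ℝ → ℝ} (hF : ∀ t, HasDerivAt F (F' t) t)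
    (hF' : Continuous F') {C : ℝ} (hC : ∀ t, ‖F' t‖ ≤ C) :
    IsWeakGradient Ω (fun x => F (w x)) (fun x => F' (w x) • G x) := by
  obtain ⟨ψ, hψ, hl, hl', hae⟩ := h.exists_approx hp
  obtain ⟨h1, h2, h3, -⟩ := h
  have hp' : (1 : ℝ≥0∞) ≤ ENNReal.ofReal p := by simpa using ENNReal.ofReal_le_ofReal hp
  have hFc : Continuous F := continuous_iff_continuousAt.2 fun t => (hF t).continuousAt
  have hwi : Integrable w (volume.restrict Ω) := h1.integrable hp'
  have hGi : Integrable G (volume.restrict Ω) := h3.integrable hp'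
  have hl1 : Tendsto (fun n => eLpNorm (fun x => ψ n x - w x) 1 (volume.restrict Ω)) atTop
      (𝓝 0) := tendsto_eLpNorm_one hp
    (fun n => (hψ n).1.continuous.aestronglyMeasurable.sub h1.1) hl
  have hl1' : Tendsto (fun n => eLpNorm (fun x => gradient (ψ n) x - G x) 1
      (volume.restrict Ω)) atTop (𝓝 0) := tendsto_eLpNorm_one hp
    (fun n => (hψ n).gradient_continuous.aestronglyMeasurable.sub h3.1) hl'
  have hgi : ∀ n, Integrable (gradient (ψ n)) (volume.restrict Ω) := fun n =>
    (hψ n).integrable_gradient.restrict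
  have hint : ∀ g : E N → ℝ, Integrable g (volume.restrict Ω) →
      Integrable (fun x => F (g x)) (volume.restrict Ω) := fun g hg => by
    -- `F 0` need not vanish; finiteness of the measure absorbs the constant.
    refine ((integrable_const ‖F 0‖).add (hg.norm.const_mul C)).mono'
      (hFc.comp_aestronglyMeasurable hg.1) (Eventually.of_forall fun x => ?_)
    have := abs_sub_le_of_hasDerivAt hF hC 0 (g x)
    rw [sub_zero] at this
    calc ‖F (g x)‖ = ‖F 0 + (F (g x) - F 0)‖ := by congr 1; ring
      _ ≤ ‖F 0‖ + ‖F (g x) - F 0‖ := norm_add_le _ _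
      _ ≤ _ := by simpa using this
  have hsm : ∀ (g : E N → ℝ) (H : E N → E N), AEStronglyMeasurable g (volume.restrict Ω) →
      Integrable H (volume.restrict Ω) →
      Integrable (fun x => F' (g x) • H x) (volume.restrict Ω) := fun g H hg hH =>
    hH.bdd_smul C (hF'.comp_aestronglyMeasurable hg) (Eventually.of_forall fun x => hC _)
  have hψi : ∀ n, Integrable (ψ n) (volume.restrict Ω) := fun n =>
    ((hψ n).1.continuous.integrable_of_hasCompactSupport (hψ n).2.1).restrict
  refine IsWeakGradient.of_tendsto (wn := fun n x => F (ψ n x))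
    (Gn := fun n x => F' (ψ n x) • gradient (ψ n) x) (hint _ hwi) (hsm _ _ h1.1 hGi)
    (fun n => hint _ (hψi n)) (fun n => hsm _ _ (hψi n).1 (hgi n))
    (fun n => IsWeakGradient.comp_testFunction (hψ n) hF hF') ?_ ?_
  · refine tendsto_of_tendsto_of_tendsto_of_le_of_le tendsto_const_nhds
      (h := fun n => ENNReal.ofReal C * eLpNorm (fun x => ψ n x - w x) 1 (volume.restrict Ω))
      ?_ (fun n => zero_le) (fun n => ?_)
    · simpa using ENNReal.Tendsto.const_mul (a := ENNReal.ofReal C) hl1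
        (Or.inr ENNReal.ofReal_ne_top)
    · exact eLpNorm_le_mul_eLpNorm_of_ae_le_mul
        (Eventually.of_forall fun x => abs_sub_le_of_hasDerivAt hF hC _ _) 1
  -- The error splits as `F'(ψ_n)(∇ψ_n - G) + (F'(ψ_n) - F'(w)) G`. The first term is controlled by
  -- the bound on `F'`, the second by dominated convergence, which is where almost everywhere
  -- convergence is needed.
  · have hA : Tendsto (fun n => ENNReal.ofReal C *
        eLpNorm (fun x => gradient (ψ n) x - G x) 1 (volume.restrict Ω)) atTop (𝓝 0) := by
      simpa using ENNReal.Tendsto.const_mul (a := ENNReal.ofReal C) hl1'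
        (Or.inr ENNReal.ofReal_ne_top)
    have hm : ∀ n, AEStronglyMeasurable (fun x => (F' (ψ n x) - F' (w x)) • G x)
        (volume.restrict Ω) := fun n =>
      ((hF'.comp_aestronglyMeasurable (hψi n).1).sub
        (hF'.comp_aestronglyMeasurable h1.1)).smul h3.1
    have hB := tendsto_eLpNorm_zero_of_dominated (p := 1) (μ := volume.restrict Ω) one_pos
      (f := fun n x => (F' (ψ n x) - F' (w x)) • G x) (g := fun x => (C + C) * ‖G x‖) hm
      (by simpa [memLp_one_iff_integrable] using hGi.norm.const_mul (C + C))
      (fun n => Eventually.of_forall fun x => by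
        rw [norm_smul]
        gcongr
        exact (norm_sub_le _ _).trans (add_le_add (hC _) (hC _)))
      (by
        filter_upwards [hae] with x hx
        have := ((hF'.tendsto (w x)).comp hx).sub_const (F' (w x)) |>.smul_const (G x)
        simpa using this)
    rw [ENNReal.ofReal_one] at hB
    have hAB := hA.add hB
    rw [add_zero] at hAB
    refine tendsto_of_tendsto_of_tendsto_of_le_of_le tendsto_const_nhds hAB
      (fun n => zero_le) (fun n => ?_)
    have hm1 : AEStronglyMeasurable (fun x => F' (ψ n x) • (gradient (ψ n) x - G x))
        (volume.restrict Ω) :=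
      (hF'.comp_aestronglyMeasurable (hψi n).1).smul ((hgi n).1.sub h3.1)
    calc eLpNorm (fun x => F' (ψ n x) • gradient (ψ n) x - F' (w x) • G x) 1 (volume.restrict Ω)
        = eLpNorm ((fun x => F' (ψ n x) • (gradient (ψ n) x - G x)) +
          fun x => (F' (ψ n x) - F' (w x)) • G x) 1 (volume.restrict Ω) := by
          congr 1
          ext1 x
          simp only [Pi.add_apply, smul_sub, sub_smul]
          abel
      _ ≤ _ := eLpNorm_add_le hm1 (hm n) le_rfl
      _ ≤ _ := by
          gcongr
          refine eLpNorm_le_mul_eLpNorm_of_ae_le_mul (Eventually.of_forall fun x => ?_) 1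
          rw [norm_smul]
          gcongr
          exact hC _

end MemW0With

/-! ### Truncation from above -/

lemma hasDerivAt_sq_max_zero (t : ℝ) :
    HasDerivAt (fun t : ℝ => (max t 0) ^ 2) (2 * max t 0) t := by
  have hne : ∀ t : ℝ, t ≠ 0 → HasDerivAt (fun t : ℝ => (max t 0) ^ 2) (2 * max t 0) t := by
    intro t ht
    rcases lt_or_gt_of_ne ht with h | h
    · rw [max_eq_right h.le, mul_zero]
      refine (hasDerivAt_const t (0 : ℝ)).congr_of_eventuallyEq ?_
      filter_upwards [Iio_mem_nhds h] with y hy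
      simp [max_eq_right (Set.mem_Iio.1 hy).le]
    · rw [max_eq_left h.le]
      have : HasDerivAt (fun t : ℝ => t ^ 2) (2 * t) t := by
        simpa using hasDerivAt_pow 2 t
      refine this.congr_of_eventuallyEq ?_
      filter_upwards [Ioi_mem_nhds h] with y hy
      simp [max_eq_left (Set.mem_Ioi.1 hy).le]
  rcases eq_or_ne t 0 with rfl | ht
  -- At the kink, the derivative is the limit of the derivatives nearby.
  · exact hasDerivAt_of_hasDerivAt_of_ne (g := fun t => 2 * max t 0) hne
      (by fun_prop) (by fun_prop)
  · exact hne t ht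

/-- A `C¹` approximation of `t ↦ min t k`. -/
noncomputable def smoothMin (k ε t : ℝ) : ℝ :=
  t - ((max (t - k) 0) ^ 2 - (max (t - k - ε) 0) ^ 2) / (2 * ε)

/-- The derivative of `smoothMin`. -/
noncomputable def smoothMinDeriv (k ε t : ℝ) : ℝ :=
  1 - (max (t - k) 0 - max (t - k - ε) 0) / ε

lemma hasDerivAt_smoothMin {k ε : ℝ} (hε : 0 < ε) (t : ℝ) :
    HasDerivAt (smoothMin k ε) (smoothMinDeriv k ε t) t := by
  have h1 : HasDerivAt (fun t : ℝ => (max (t - k) 0) ^ 2) (2 * max (t - k) 0) t := 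
    (hasDerivAt_sq_max_zero (t - k)).comp_sub_const t k
  have h2 : HasDerivAt (fun t : ℝ => (max (t - k - ε) 0) ^ 2) (2 * max (t - k - ε) 0) t := 
    ((hasDerivAt_sq_max_zero (t - k - ε)).comp_sub_const (t - k) ε).comp_sub_const t k
  have h3 : HasDerivAt (smoothMin k ε)
      (1 - (2 * max (t - k) 0 - 2 * max (t - k - ε) 0) / (2 * ε)) t :=
    (hasDerivAt_id t).sub ((h1.sub h2).div_const (2 * ε))
  refine h3.congr_deriv ?_
  rw [smoothMinDeriv]
  field_simp

lemma continuous_smoothMinDeriv (k ε : ℝ) : Continuous (smoothMinDeriv k ε) := by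
  unfold smoothMinDeriv
  fun_prop

/-- The subtracted quotient is a ramp rising from `0` at `k` to `1` at `k + ε`. -/
lemma norm_smoothMinDeriv_le (k t : ℝ) {ε : ℝ} (hε : 0 < ε) : ‖smoothMinDeriv k ε t‖ ≤ 1 := by
  have h0 : 0 ≤ (max (t - k) 0 - max (t - k - ε) 0) / ε := by
    refine div_nonneg (sub_nonneg.2 (max_le_max (by linarith) le_rfl)) hε.le
  have h1 : (max (t - k) 0 - max (t - k - ε) 0) / ε ≤ 1 := by
    rw [div_le_one hε]
    have : max (t - k) 0 ≤ max (t - k - ε) 0 + ε :=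
      max_le (by linarith [le_max_left (t - k - ε) 0]) (by linarith [le_max_right (t - k - ε) 0])
    linarith
  rw [smoothMinDeriv, Real.norm_eq_abs, abs_le]
  constructor <;> linarith

lemma smoothMin_of_le {k ε t : ℝ} (hε : 0 < ε) (h : t ≤ k) : smoothMin k ε t = t := by
  rw [smoothMin, max_eq_right (by linarith), max_eq_right (by linarith)]
  simp

lemma smoothMinDeriv_of_le {k ε t : ℝ} (hε : 0 < ε) (h : t ≤ k) : smoothMinDeriv k ε t = 1 := by
  rw [smoothMinDeriv, max_eq_right (by linarith), max_eq_right (by linarith)]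
  simp

lemma smoothMin_of_add_le {k ε t : ℝ} (hε : 0 < ε) (h : k + ε ≤ t) :
    smoothMin k ε t = k + ε / 2 := by
  rw [smoothMin, max_eq_left (by linarith), max_eq_left (by linarith)]
  field_simp
  ring

lemma smoothMinDeriv_of_add_le {k ε t : ℝ} (hε : 0 < ε) (h : k + ε ≤ t) :
    smoothMinDeriv k ε t = 0 := by
  rw [smoothMinDeriv, max_eq_left (by linarith), max_eq_left (by linarith)]
  field_simp
  ring

lemma norm_smoothMin_le {k ε : ℝ} (hk : 0 < k) (hε : 0 < ε) (t : ℝ) :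
    ‖smoothMin k ε t‖ ≤ ‖t‖ := by
  have := abs_sub_le_of_hasDerivAt (hasDerivAt_smoothMin (k := k) hε)
    (fun t => norm_smoothMinDeriv_le k t hε) 0 t
  rwa [smoothMin_of_le hε hk.le, sub_zero, sub_zero, one_mul] at this

/-- The weak gradient of the truncation from above of a function in `W^{1,p}_0(Ω)`. -/
lemma MemW0With.isWeakGradient_min [IsFiniteMeasure (volume.restrict Ω)] {p : ℝ} (hp : 1 ≤ p)
    {w : E N → ℝ} {G : E N → E N} (h : MemW0With p Ω w G) {k : ℝ} (hk : 0 < k) :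
    IsWeakGradient Ω (fun x => min (w x) k) ({x | w x ≤ k}.indicator G) := by
  have hp' : (1 : ℝ≥0∞) ≤ ENNReal.ofReal p := by simpa using ENNReal.ofReal_le_ofReal hp
  have hwi : Integrable w (volume.restrict Ω) := h.1.integrable hp'
  have hGi : Integrable G (volume.restrict Ω) := h.2.2.1.integrable hp'
  set ε : ℕ → ℝ := fun n => 1 / ((n : ℝ) + 1) with hεdef
  have hε : ∀ n, 0 < ε n := fun n => Nat.one_div_pos_of_nat
  have hεlim : Tendsto ε atTop (𝓝 0) := tendsto_one_div_add_atTop_nhds_zero_nat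
  have hFc : ∀ n, Continuous (smoothMin k (ε n)) := fun n =>
    continuous_iff_continuousAt.2 fun t => (hasDerivAt_smoothMin (hε n) t).continuousAt
  have hset : NullMeasurableSet {x | w x ≤ k} (volume.restrict Ω) :=
    nullMeasurableSet_le hwi.aemeasurable aemeasurable_const
  have hind : Integrable ({x | w x ≤ k}.indicator G) (volume.restrict Ω) :=
    hGi.indicator₀ hset
  have hmin : Integrable (fun x => min (w x) k) (volume.restrict Ω) :=
    hwi.inf (integrable_const k)
  have hsm : ∀ n, Integrable (fun x => smoothMin k (ε n) (w x)) (volume.restrict Ω) := fun n =>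
    hwi.mono ((hFc n).comp_aestronglyMeasurable hwi.1)
      (Eventually.of_forall fun x => norm_smoothMin_le hk (hε n) _)
  have hsmd : ∀ n, Integrable (fun x => smoothMinDeriv k (ε n) (w x) • G x)
      (volume.restrict Ω) := fun n =>
    hGi.bdd_smul 1 ((continuous_smoothMinDeriv k (ε n)).comp_aestronglyMeasurable hwi.1)
      (Eventually.of_forall fun x => norm_smoothMinDeriv_le k _ (hε n))
  refine IsWeakGradient.of_tendsto (wn := fun n x => smoothMin k (ε n) (w x))
    (Gn := fun n x => smoothMinDeriv k (ε n) (w x) • G x) hmin hind hsm hsmd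
    (fun n => h.isWeakGradient_comp hp (fun t => hasDerivAt_smoothMin (hε n) t)
      (continuous_smoothMinDeriv k _) (fun t => norm_smoothMinDeriv_le k t (hε n))) ?_ ?_
  · have := tendsto_eLpNorm_zero_of_dominated (p := 1) (μ := volume.restrict Ω) one_pos
      (f := fun n x => smoothMin k (ε n) (w x) - min (w x) k) (g := fun x => ‖w x‖ + ‖w x‖)
      (fun n => (hsm n).1.sub hmin.1)
      (by rw [ENNReal.ofReal_one]; exact memLp_one_iff_integrable.2 (hwi.norm.add hwi.norm))
      (fun n => Eventually.of_forall fun x => (norm_sub_le _ _).trans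
        (add_le_add (norm_smoothMin_le hk (hε n) _) ?_)) (Eventually.of_forall fun x => ?_)
    · simpa using this
    · rcases le_total (w x) k with h | h
      · rw [min_eq_left h]
      · rw [min_eq_right h, Real.norm_of_nonneg hk.le, Real.norm_of_nonneg (hk.le.trans h)]
        exact h
    · rcases le_or_gt (w x) k with h | h
      · simp [smoothMin_of_le (hε _) h, min_eq_left h]
      · have hev : ∀ᶠ n in atTop, ε n < w x - k := hεlim.eventually_lt_const (by linarith)
        have h2 : Tendsto (fun n => ε n / 2) atTop (𝓝 0) := by simpa using hεlim.div_const 2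
        refine h2.congr' ?_
        filter_upwards [hev] with n hn
        rw [smoothMin_of_add_le (hε n) (by linarith), min_eq_right h.le]
        ring
  · have := tendsto_eLpNorm_zero_of_dominated (p := 1) (μ := volume.restrict Ω) one_pos
      (f := fun n x => smoothMinDeriv k (ε n) (w x) • G x - {x | w x ≤ k}.indicator G x)
      (g := fun x => ‖G x‖ + ‖G x‖)
      (fun n => (hsmd n).1.sub hind.1)
      (by rw [ENNReal.ofReal_one]; exact memLp_one_iff_integrable.2 (hGi.norm.add hGi.norm))
      (fun n => Eventually.of_forall fun x => (norm_sub_le _ _).trans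
        (add_le_add ?_ (norm_indicator_le_norm_self _ _))) (Eventually.of_forall fun x => ?_)
    · simpa using this
    · rw [norm_smul]
      exact mul_le_of_le_one_left (norm_nonneg _) (norm_smoothMinDeriv_le k _ (hε n))
    -- The ramp lies to the right of `k`: the derivative is `1` at `k` itself, whence the closed
    -- condition `w ≤ k` in the limit, and each point above `k` eventually leaves the ramp.
    · rcases le_or_gt (w x) k with h | h
      · simp [smoothMinDeriv_of_le (hε _) h, h]
      · have hev : ∀ᶠ n in atTop, ε n < w x - k := hεlim.eventually_lt_const (by linarith)
        refine tendsto_const_nhds.congr' ?_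
        filter_upwards [hev] with n hn
        rw [smoothMinDeriv_of_add_le (hε n) (by linarith),
          Set.indicator_of_notMem (by simpa using h)]
        simp

/-! ### Sobolev inequality and closedness -/

/-- The Sobolev inequality in `W^{1,p}_0(Ω)`. -/
lemma MemW0With.exists_sobolev {p q : ℝ} (hp : 1 ≤ p) (hN : 0 < N) (hq : 0 < q)
    (hpq : q⁻¹ = p⁻¹ - (N : ℝ)⁻¹) :
    ∃ S : ℝ≥0∞, S ≠ ⊤ ∧ ∀ (w : E N → ℝ) (G : E N → E N), MemW0With p Ω w G →
      eLpNorm w (ENNReal.ofReal q) (volume.restrict Ω) ≤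
        S * eLpNorm G (ENNReal.ofReal p) (volume.restrict Ω) := by
  have hp' : (1 : ℝ≥0∞) ≤ ENNReal.ofReal p := by simpa using ENNReal.ofReal_le_ofReal hp
  have hfin : Module.finrank ℝ (E N) = N := by simp
  set S : ℝ≥0∞ :=
    ((SNormLESNormFDerivOfEqConst ℝ (volume : Measure (E N)) p.toNNReal : NNReal) : ℝ≥0∞) with hS
  have hST : S ≠ ⊤ := ENNReal.coe_ne_top
  refine ⟨S, hST, fun w G h => ?_⟩
  obtain ⟨ψ, hψ, hl, hl', hae⟩ := h.exists_approx hp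
  have hb : ∀ n, eLpNorm (ψ n) (ENNReal.ofReal q) (volume.restrict Ω) ≤
      S * (eLpNorm (fun x => gradient (ψ n) x - G x) (ENNReal.ofReal p) (volume.restrict Ω) +
        eLpNorm G (ENNReal.ofReal p) (volume.restrict Ω)) := by
    intro n
    have h1 : eLpNorm (ψ n) (ENNReal.ofReal q) volume ≤
        S * eLpNorm (fderiv ℝ (ψ n)) (ENNReal.ofReal p) volume :=
      eLpNorm_le_eLpNorm_fderiv_of_eq (F := ℝ) (volume : Measure (E N)) (u := ψ n)
        (p := p.toNNReal) (p' := q.toNNReal)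
        ((hψ n).1.of_le (by simp)) (hψ n).2.1 (by simpa using Real.toNNReal_le_toNNReal hp)
        (by rw [hfin]; exact hN)
        (by
          rw [hfin, NNReal.coe_inv, Real.coe_toNNReal _ hq.le,
            Real.coe_toNNReal _ (by linarith), hpq])
    have h2 : eLpNorm (fderiv ℝ (ψ n)) (ENNReal.ofReal p) volume =
        eLpNorm (gradient (ψ n)) (ENNReal.ofReal p) (volume.restrict Ω) := by
      rw [eLpNorm_restrict_eq_of_support_subset (hψ n).support_gradient_subset]
      exact eLpNorm_congr_norm_ae (Eventually.of_forall fun x => (norm_gradient _ x).symm)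
    calc _ ≤ eLpNorm (ψ n) (ENNReal.ofReal q) volume := eLpNorm_mono_measure _ Measure.restrict_le_self
      _ ≤ S * eLpNorm (gradient (ψ n)) (ENNReal.ofReal p) (volume.restrict Ω) := h2 ▸ h1
      _ ≤ _ := by
        gcongr
        refine le_trans (le_of_eq ?_) (eLpNorm_add_le
          ((hψ n).gradient_continuous.aestronglyMeasurable.sub h.2.2.1.1) h.2.2.1.1 hp')
        congr 1
        ext1 x
        simp
  -- Convergence in `L^q` is not known, but Fatou needs only almost everywhere convergence.
  refine (Lp.eLpNorm_lim_le_liminf_eLpNorm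
    (fun n => (hψ n).1.continuous.aestronglyMeasurable) _ hae).trans ?_
  have hlim : Tendsto (fun n => S * (eLpNorm (fun x => gradient (ψ n) x - G x) (ENNReal.ofReal p)
      (volume.restrict Ω) + eLpNorm G (ENNReal.ofReal p) (volume.restrict Ω))) atTop
      (𝓝 (S * (0 + eLpNorm G (ENNReal.ofReal p) (volume.restrict Ω)))) :=
    ENNReal.Tendsto.const_mul (hl'.add tendsto_const_nhds) (Or.inr hST)
  rw [zero_add] at hlim
  rw [← hlim.liminf_eq]
  exact liminf_le_liminf (Eventually.of_forall hb)

/-- `W^{1,p}_0(Ω)` is closed under convergence of functions and gradients in `L^p`. -/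
lemma MemW0With.of_tendsto [IsFiniteMeasure (volume.restrict Ω)] {p : ℝ} (hp : 1 ≤ p)
    {w : E N → ℝ} {G : E N → E N} {wn : ℕ → E N → ℝ} {Gn : ℕ → E N → E N}
    (hw : MemLp w (ENNReal.ofReal p) (volume.restrict Ω))
    (hG : MemLp G (ENNReal.ofReal p) (volume.restrict Ω))
    (h : ∀ n, MemW0With p Ω (wn n) (Gn n))
    (hlim : Tendsto (fun n => eLpNorm (fun x => wn n x - w x) (ENNReal.ofReal p)
      (volume.restrict Ω)) atTop (𝓝 0))
    (hlim' : Tendsto (fun n => eLpNorm (fun x => Gn n x - G x) (ENNReal.ofReal p)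
      (volume.restrict Ω)) atTop (𝓝 0)) :
    MemW0With p Ω w G := by
  have hp' : (1 : ℝ≥0∞) ≤ ENNReal.ofReal p := by simpa using ENNReal.ofReal_le_ofReal hp
  have hcl : IsWeakGradient Ω w G :=
    IsWeakGradient.of_tendsto (hw.integrable hp') (hG.integrable hp')
      (fun n => (h n).1.integrable hp') (fun n => (h n).2.2.1.integrable hp')
      (fun n => (h n).2.1)
      (tendsto_eLpNorm_one hp (fun n => (h n).1.1.sub hw.1) hlim)
      (tendsto_eLpNorm_one hp (fun n => (h n).2.2.1.1.sub hG.1) hlim')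
  have hε : ∀ n : ℕ, (0 : ℝ≥0∞) < ((n : ℝ≥0∞) + 1)⁻¹ := fun n => by simp
  have hεlim : Tendsto (fun n : ℕ => ((n : ℝ≥0∞) + 1)⁻¹) atTop (𝓝 0) := by
    have := (tendsto_add_atTop_iff_nat 1).2 ENNReal.tendsto_inv_nat_nhds_zero
    simpa using this
  have hex : ∀ n, ∃ ψ : E N → ℝ, IsTestFunction Ω ψ ∧
      eLpNorm (fun x => ψ x - wn n x) (ENNReal.ofReal p) (volume.restrict Ω) <
        ((n : ℝ≥0∞) + 1)⁻¹ ∧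
      eLpNorm (fun x => gradient ψ x - Gn n x) (ENNReal.ofReal p) (volume.restrict Ω) <
        ((n : ℝ≥0∞) + 1)⁻¹ := fun n => by
    obtain ⟨-, -, -, ψ, hψ, h1, h2⟩ := h n
    obtain ⟨i, hi⟩ := ((h1.eventually_lt_const (hε n)).and
      (h2.eventually_lt_const (hε n))).exists
    exact ⟨ψ i, hψ i, hi⟩
  choose ψ hψ h1 h2 using hex
  refine ⟨hw, hcl, hG, ψ, hψ, ?_, ?_⟩
  · have := hεlim.add hlim
    rw [add_zero] at this
    refine tendsto_of_tendsto_of_tendsto_of_le_of_le tendsto_const_nhds this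
      (fun n => zero_le) (fun n => ?_)
    refine le_trans (le_of_eq ?_) ((eLpNorm_add_le (f := fun x => ψ n x - wn n x)
      (g := fun x => wn n x - w x) ((hψ n).1.continuous.aestronglyMeasurable.sub (h n).1.1)
      ((h n).1.1.sub hw.1) hp').trans (add_le_add (h1 n).le le_rfl))
    congr 1
    ext x
    simp
  · have := hεlim.add hlim'
    rw [add_zero] at this
    refine tendsto_of_tendsto_of_tendsto_of_le_of_le tendsto_const_nhds this
      (fun n => zero_le) (fun n => ?_)
    refine le_trans (le_of_eq ?_) ((eLpNorm_add_le (f := fun x => gradient (ψ n) x - Gn n x)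
      (g := fun x => Gn n x - G x)
      ((hψ n).gradient_continuous.aestronglyMeasurable.sub (h n).2.2.1.1)
      ((h n).2.2.1.1.sub hG.1) hp').trans (add_le_add (h2 n).le le_rfl))
    congr 1
    ext1 x
    simp

/-! ### Truncations and the generalized gradient -/

lemma trunc_of_nonneg {k s : ℝ} (hk : 0 < k) (hs : 0 ≤ s) : trunc k s = min s k := by
  rw [trunc, max_eq_right]
  exact (neg_nonpos.2 hk.le).trans (le_min hs hk.le)

lemma continuous_trunc (k : ℝ) : Continuous (trunc k) := by
  unfold trunc
  fun_prop

lemma abs_trunc_le {k : ℝ} (hk : 0 < k) (s : ℝ) : |trunc k s| ≤ k := by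
  rw [trunc, abs_le]
  exact ⟨le_max_left _ _, max_le (by linarith) (min_le_right _ _)⟩

/-- Existence of the generalized gradient of a nonnegative function with truncations in
`W^{1,p}_0(Ω)`. -/
lemma exists_isGenGradient (hΩ : IsOpen Ω) [IsFiniteMeasure (volume.restrict Ω)] {p : ℝ}
    (hp : 1 ≤ p) {u : E N → ℝ} (hu0 : ∀ᵐ x ∂volume.restrict Ω, 0 ≤ u x)
    (hu : ∀ k : ℝ, 0 < k → MemW0 p Ω (fun x => trunc k (u x))) :
    ∃ v : E N → E N, IsGenGradient Ω u v ∧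
      ∀ k : ℝ, 0 < k → MemW0With p Ω (fun x => trunc k (u x)) ({x | |u x| ≤ k}.indicator v) := by
  have hex : ∀ k : ℝ, ∃ G : E N → E N, 0 < k → MemW0With p Ω (fun x => trunc k (u x)) G := by
    intro k
    by_cases hk : 0 < k
    · obtain ⟨G, hG⟩ := memW0_iff.1 (hu k hk)
      exact ⟨G, fun _ => hG⟩
    · exact ⟨0, fun h => absurd h hk⟩
  choose G hG using hex
  -- For `u ≥ 0`, `T_k(u) = min (T_m(u)) k`, so truncation and uniqueness make the gradients
  -- compatible across levels.
  have hcons : ∀ k m : ℝ, 0 < k → k < m →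
      G k =ᵐ[volume.restrict Ω] {x | |u x| ≤ k}.indicator (G m) := by
    intro k m hk hkm
    have hm : 0 < m := hk.trans hkm
    have h1 := (hG m hm).isWeakGradient_min hp hk
    refine (hG k hk).2.1.unique hΩ (h1.congr ?_ ?_)
    · filter_upwards [hu0] with x hx
      rw [trunc_of_nonneg hm hx, trunc_of_nonneg hk hx, min_assoc, min_eq_right hkm.le]
    · filter_upwards [hu0] with x hx
      have : (x ∈ {x | trunc m (u x) ≤ k}) ↔ x ∈ {x | |u x| ≤ k} := by
        simp only [Set.mem_ofPred_eq]
        rw [trunc_of_nonneg hm hx, abs_of_nonneg hx, min_le_iff]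
        exact or_iff_left (by linarith)
      by_cases hxk : x ∈ {x | |u x| ≤ k}
      · rw [Set.indicator_of_mem hxk, Set.indicator_of_mem (this.2 hxk)]
      · rw [Set.indicator_of_notMem hxk, Set.indicator_of_notMem (fun h => hxk (this.1 h))]
  -- An integer level above `|u x|`; the added `1` keeps it positive where `u` vanishes. The field
  -- `v` reads off at each point the gradient of the truncation at this level.
  set n : E N → ℕ := fun x => ⌊|u x|⌋₊ + 1 with hn
  have hun : ∀ x, |u x| ≤ n x := fun x => by
    simpa [hn] using (Nat.lt_floor_add_one |u x|).le
  set v : E N → E N := fun x => G (n x) x with hv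
  have hall : ∀ᵐ x ∂volume.restrict Ω, ∀ i j : ℕ, 0 < i → i < j →
      G i x = {x | |u x| ≤ i}.indicator (G j) x := by
    simp only [ae_all_iff]
    intro i j hi hij
    exact hcons i j (by exact_mod_cast hi) (by exact_mod_cast hij)
  have hvG : ∀ᵐ x ∂volume.restrict Ω, ∀ m : ℕ, n x < m → G m x = v x := by
    filter_upwards [hall] with x hx m hm
    have := hx (n x) m (Nat.succ_pos _) hm
    rw [Set.indicator_of_mem (show x ∈ {y | |u y| ≤ (n x : ℝ)} from hun x)] at this
    exact this.symm
  have hGk : ∀ k : ℝ, 0 < k → G k =ᵐ[volume.restrict Ω] {x | |u x| ≤ k}.indicator v := by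
    intro k hk
    -- A real level `k` is compared with integer levels only, so that countably many null sets
    -- suffice.
    have h1 : ∀ᵐ x ∂volume.restrict Ω, ∀ m : ℕ, k < m →
        G k x = {x | |u x| ≤ k}.indicator (G m) x := by
      rw [ae_all_iff]
      intro m
      by_cases hkm : k < m
      · filter_upwards [hcons k m hk hkm] with x hx _ using hx
      · exact Eventually.of_forall fun x h => absurd h hkm
    filter_upwards [h1, hvG] with x hx hxv
    obtain ⟨m, hm⟩ := exists_nat_gt k
    rw [hx (max m (n x + 1)) (hm.trans_le (by exact_mod_cast le_max_left _ _))]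
    by_cases hxk : x ∈ {x | |u x| ≤ k}
    · rw [Set.indicator_of_mem hxk, Set.indicator_of_mem hxk]
      exact hxv _ (lt_of_lt_of_le (Nat.lt_succ_self _) (le_max_right _ _))
    · rw [Set.indicator_of_notMem hxk, Set.indicator_of_notMem hxk]
  have hW : ∀ k : ℝ, 0 < k →
      MemW0With p Ω (fun x => trunc k (u x)) ({x | |u x| ≤ k}.indicator v) := fun k hk =>
    (hG k hk).congr EventuallyEq.rfl (hGk k hk)
  refine ⟨v, ⟨?_, fun k hk => (hW k hk).2.1⟩, hW⟩
  refine aemeasurable_of_tendsto_metrizable_ae' (f := fun (m : ℕ) => G ((m : ℝ) + 1))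
    (fun m => (hG _ (by positivity)).2.2.1.1.aemeasurable) ?_
  filter_upwards [hvG] with x hx
  refine tendsto_const_nhds.congr' ?_
  filter_upwards [eventually_ge_atTop (n x)] with m hm
  have := hx (m + 1) (Nat.lt_succ_of_le hm)
  rw [← this]
  push_cast
  rfl

/-! ### Dyadic levels and slices -/

/-- Superexponential decay gives summability against every geometric weight. -/
lemma tsum_pow_mul_lt_top {M δ : ℕ → ℝ≥0∞} (hM : ∀ j, M j ≠ ⊤)
    (hrec : ∀ j, M (j + 1) ≤ δ j * M j) (hδ : Tendsto δ atTop (𝓝 0)) {c : ℝ≥0∞} (hc : c ≠ ⊤) :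
    ∑' j, c ^ j * M j < ⊤ := by
  have hcδ : Tendsto (fun j => c * δ j) atTop (𝓝 0) := by
    simpa using ENNReal.Tendsto.const_mul (a := c) hδ (Or.inr hc)
  -- From `J` on, `c δ_j ≤ 1/2`, so the weighted terms at least halve at each step.
  obtain ⟨J, hJ⟩ := eventually_atTop.1
    (hcδ.eventually_le_const (show (0 : ℝ≥0∞) < 2⁻¹ by simp))
  have hfin : ∀ j, c ^ j * M j ≠ ⊤ := fun j => ENNReal.mul_ne_top (ENNReal.pow_ne_top hc) (hM j)
  have hdec : ∀ i, c ^ (i + J) * M (i + J) ≤ 2⁻¹ ^ i * (c ^ J * M J) := by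
    intro i
    induction i with
    | zero => simp
    | succ i ih =>
      calc c ^ (i + 1 + J) * M (i + 1 + J)
          = c ^ (i + J) * c * M ((i + J) + 1) := by
            rw [show i + 1 + J = (i + J) + 1 by ring, pow_succ]
        _ ≤ c ^ (i + J) * c * (δ (i + J) * M (i + J)) := by gcongr; exact hrec _
        _ = (c * δ (i + J)) * (c ^ (i + J) * M (i + J)) := by ring
        _ ≤ 2⁻¹ * (2⁻¹ ^ i * (c ^ J * M J)) := by
            gcongr
            exact hJ _ (Nat.le_add_left _ _)
        _ = 2⁻¹ ^ (i + 1) * (c ^ J * M J) := by rw [pow_succ' (2⁻¹ : ℝ≥0∞), mul_assoc]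
  have hgeo : ∑' i : ℕ, (2⁻¹ : ℝ≥0∞) ^ i * (c ^ J * M J) < ⊤ := by
    rw [ENNReal.tsum_mul_right, ENNReal.tsum_geometric, ENNReal.one_sub_inv_two, inv_inv]
    exact ENNReal.mul_lt_top ENNReal.ofNat_lt_top (hfin J).lt_top
  have htail : ∑' i : ℕ, c ^ (i + J) * M (i + J) < ⊤ :=
    (ENNReal.tsum_le_tsum hdec).trans_lt hgeo
  have hhead : ∑ i ∈ Finset.range J, c ^ i * M i < ⊤ :=
    ENNReal.sum_lt_top.2 fun j _ => (hfin j).lt_top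
  have hsplit : ∑ i ∈ Finset.range J, c ^ i * M i + ∑' i : ℕ, c ^ (i + J) * M (i + J) =
      ∑' j, c ^ j * M j := ENNReal.summable.sum_add_tsum_nat_add' (f := fun j => c ^ j * M j)
  exact hsplit ▸ ENNReal.add_lt_top.2 ⟨hhead, htail⟩

lemma exists_dyadic {t y : ℝ} (ht : 0 < t) (hy : t < y) :
    ∃ j : ℕ, t * 2 ^ j < y ∧ y ≤ t * 2 ^ (j + 1) := by
  classical
  have hex : ∃ n : ℕ, y ≤ t * 2 ^ n := by
    obtain ⟨n, hn⟩ := pow_unbounded_of_one_lt (y / t) (one_lt_two)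
    exact ⟨n, by rw [div_lt_iff₀ ht] at hn; linarith⟩
  obtain ⟨j, hj⟩ : ∃ j, Nat.find hex = j + 1 := Nat.exists_eq_succ_of_ne_zero fun h => by
    have := Nat.find_spec hex
    rw [h] at this
    simp at this
    linarith
  refine ⟨j, ?_, hj ▸ Nat.find_spec hex⟩
  exact not_le.1 (Nat.find_min hex (by omega))

/-- This turns the function in the entropy inequality for `φ = T_t(u)`, `k = t` into a difference of
truncations, whose gradient is known. -/
lemma trunc_sub_trunc {t : ℝ} (ht : 0 < t) (s : ℝ) :
    trunc t (s - trunc t s) = trunc (2 * t) s - trunc t s := by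
  simp only [trunc]
  grind

lemma trunc_of_abs_le {k s : ℝ} (h : |s| ≤ k) : trunc k s = s := by
  rw [abs_le] at h
  rw [trunc, min_eq_left h.2, max_eq_right h.1]

lemma memW0With_slice {p : ℝ} (hp : 1 ≤ p) {u : E N → ℝ} {v : E N → E N}
    (hW : ∀ k : ℝ, 0 < k →
      MemW0With p Ω (fun x => trunc k (u x)) ({x | |u x| ≤ k}.indicator v))
    {t : ℝ} (ht : 0 < t) :
    MemW0With p Ω (fun x => trunc (2 * t) (u x) - trunc t (u x))
      ({x | t < |u x| ∧ |u x| ≤ 2 * t}.indicator v) := by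
  refine ((hW (2 * t) (by positivity)).sub hp (hW t ht)).congr EventuallyEq.rfl
    (Eventually.of_forall fun x => ?_)
  simp only [Set.indicator_apply, Set.mem_ofPred_eq]
  by_cases h1 : |u x| ≤ t
  · simp [h1, not_lt.2 h1, h1.trans (show t ≤ 2 * t by linarith)]
  · by_cases h2 : |u x| ≤ 2 * t
    · simp [h1, h2, not_le.1 h1]
    · simp [h1, h2]

/-- The energy estimate on a dyadic slice, obtained by testing with `φ = T_t(u)`. -/
lemma IsEntropySolution.lintegral_slice_le [IsFiniteMeasure (volume.restrict Ω)] {p : ℝ} (hp : 1 < p)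
    {a : E N → ℝ → E N → E N} {b : ℝ → ℝ}
    (hcoer : ∀ᵐ x ∂volume.restrict Ω, ∀ (s : ℝ) (ξ : E N), b s * ‖ξ‖ ^ p ≤ inner ℝ (a x s ξ) ξ)
    {α γ : ℝ} (hα : 0 < α) (hγ : 0 ≤ γ) (hb : ∀ s, α / (1 + |s|) ^ (p - 1 + γ) ≤ b s)
    {h : ℝ → ℝ≥0∞} {c s₀ : ℝ} (hc : 0 < c)
    (hh : ∀ s, s₀ ≤ s → h s ≤ ENNReal.ofReal (c / s ^ γ))
    {f u : E N → ℝ} (hf0 : ∀ᵐ x ∂volume.restrict Ω, 0 ≤ f x)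
    (hf : Integrable f (volume.restrict Ω)) (hu : IsEntropySolution p Ω a h f u)
    {v : E N → E N} (hv : IsGenGradient Ω u v)
    (hW : ∀ k : ℝ, 0 < k →
      MemW0With p Ω (fun x => trunc k (u x)) ({x | |u x| ≤ k}.indicator v))
    {t : ℝ} (ht1 : 1 ≤ t) (hts : s₀ ≤ t) :
    ∫⁻ x in Ω, ‖{x | t < |u x| ∧ |u x| ≤ 2 * t}.indicator v x‖ₑ ^ p ≤
      ENNReal.ofReal (3 ^ (p - 1 + γ) * c / α * t ^ p) *
        ∫⁻ x in {x | t < |u x|}, ‖f x‖ₑ ∂volume.restrict Ω := by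
  have ht : 0 < t := by linarith
  set μ := volume.restrict Ω with hμ
  set H : E N → E N := {x | t < |u x| ∧ |u x| ≤ 2 * t}.indicator v with hHdef
  have hs := memW0With_slice hp.le hW ht
  rw [← hHdef] at hs
  have hHp : MemLp H (ENNReal.ofReal p) μ := hs.2.2.1
  have hset : NullMeasurableSet {x | t < |u x|} μ :=
    nullMeasurableSet_lt aemeasurable_const hu.aemeasurable.abs
  have hent := hu.entropy_le v hv t ht (fun x => trunc t (u x)) (hu.trunc_mem t ht)
    (MemLp.of_bound ((continuous_trunc t).comp_aestronglyMeasurable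
      hu.aemeasurable.aestronglyMeasurable) t (Eventually.of_forall fun x => abs_trunc_le ht _))
    H (by simpa only [trunc_sub_trunc ht] using hs.2.1)
  rw [← hμ] at hent
  -- integrability of the flux term
  have hAp := hu.flux_memLp (2 * t) (by positivity) _ (hW (2 * t) (by positivity)).2.1
  set A : E N → E N :=
    fun x => a x (trunc (2 * t) (u x)) ({x | |u x| ≤ 2 * t}.indicator v x) with hAdef
  -- On the slice the flux is that of `T_{2t}(u)`, which lies in `L^{p/(p-1)}`; off it `H = 0`.
  -- Hence the pairing is integrable and its integral can be bounded from below.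
  have hAH : ∀ x, inner ℝ (a x (u x) (v x)) (H x) = inner ℝ (A x) (H x) := by
    intro x
    by_cases hx : x ∈ {x | t < |u x| ∧ |u x| ≤ 2 * t}
    · have h2 : x ∈ {x | |u x| ≤ 2 * t} := hx.2
      simp only [hAdef]
      rw [Set.indicator_of_mem h2, trunc_of_abs_le hx.2]
    · have : H x = 0 := Set.indicator_of_notMem hx _
      simp [this]
  have hpq : p.HolderConjugate (p / (p - 1)) := Real.HolderConjugate.conjExponent hp
  have hintA : Integrable (fun x => inner ℝ (a x (u x) (v x)) (H x)) μ := by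
    simp only [hAH]
    have : ENNReal.HolderTriple (ENNReal.ofReal (p / (p - 1))) (ENNReal.ofReal p) 1 :=
      hpq.symm.ennrealOfReal
    exact (hAp.norm.integrable_mul hHp.norm).mono' (hAp.1.inner hHp.1)
      (Eventually.of_forall fun x => norm_inner_le_norm _ _)
  have hHi : Integrable (fun x => ‖H x‖ ^ p) μ := by
    have := hHp.integrable_norm_rpow (by simpa using (by linarith : 0 < p)) ENNReal.ofReal_ne_top
    rwa [ENNReal.toReal_ofReal (by linarith)] at this
  -- A lower bound for `b(u)` on the slice: there `1 + |u| ≤ 1 + 2t ≤ 3t`, as `t ≥ 1`.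
  set β : ℝ := α / (3 * t) ^ (p - 1 + γ) with hβ
  have hβ0 : 0 < β := by positivity
  have he : 0 ≤ p - 1 + γ := by linarith
  -- lower bound
  have hlow : β * ∫ x, ‖H x‖ ^ p ∂μ ≤ ∫ x, inner ℝ (a x (u x) (v x)) (H x) ∂μ := by
    rw [← integral_const_mul]
    refine integral_mono_ae (hHi.const_mul β) hintA ?_
    filter_upwards [hcoer] with x hx
    by_cases hxs : x ∈ {x | t < |u x| ∧ |u x| ≤ 2 * t}
    · have hHx : H x = v x := Set.indicator_of_mem hxs _
      simp only [hHx]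
      refine le_trans ?_ (hx (u x) (v x))
      gcongr
      refine le_trans ?_ (hb (u x))
      rw [hβ]
      gcongr
      linarith [hxs.2]
    · have hHx : H x = 0 := Set.indicator_of_notMem hxs _
      simp [hHx, Real.zero_rpow (by linarith : p ≠ 0)]
  -- upper bound
  have hup : ∫ x, (source h f u x).toReal * trunc t (u x - trunc t (u x)) ∂μ ≤
      c / t ^ γ * t * ∫ x, {x | t < |u x|}.indicator f x ∂μ := by
    rw [← integral_const_mul]
    have hpt : ∀ᵐ x ∂μ, 0 ≤ (source h f u x).toReal * trunc t (u x - trunc t (u x)) ∧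
        (source h f u x).toReal * trunc t (u x - trunc t (u x)) ≤
          c / t ^ γ * t * {x | t < |u x|}.indicator f x := by
      filter_upwards [hf0, hu.nonneg] with x hfx hux
      by_cases hxs : x ∈ {x | t < |u x|}
      · have htu : t < u x := by simpa [abs_of_nonneg hux] using hxs
        have h1 : trunc t (u x) = t := by rw [trunc_of_nonneg ht hux, min_eq_right htu.le]
        have h2 : 0 ≤ trunc t (u x - t) := by
          rw [trunc_of_nonneg ht (by linarith)]
          exact le_min (by linarith) ht.le
        have h3 : trunc t (u x - t) ≤ t := (le_abs_self _).trans (abs_trunc_le ht _)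
        have h4 : (source h f u x).toReal ≤ c / t ^ γ * f x := by
          rw [source, ENNReal.toReal_mul, ENNReal.toReal_ofReal hfx]
          gcongr
          refine ENNReal.toReal_le_of_le_ofReal (by positivity)
            ((hh _ (by linarith)).trans (ENNReal.ofReal_le_ofReal ?_))
          gcongr
        rw [Set.indicator_of_mem hxs, h1]
        refine ⟨by positivity, ?_⟩
        calc _ ≤ c / t ^ γ * f x * t := by gcongr
          _ = _ := by ring
      · have hut : |u x| ≤ t := not_lt.1 hxs
        have h1 : trunc t (u x - trunc t (u x)) = 0 := by
          rw [trunc_of_abs_le hut, sub_self, trunc_of_abs_le (by simpa using ht.le)]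
        rw [Set.indicator_of_notMem hxs, h1]
        simp
    -- As the source term is nonnegative, only its majorant has to be integrable.
    exact integral_mono_of_nonneg (hpt.mono fun x hx => hx.1)
      ((hf.indicator₀ hset).const_mul _) (hpt.mono fun x hx => hx.2)
  have hmain : ∫ x, ‖H x‖ ^ p ∂μ ≤
      3 ^ (p - 1 + γ) * c / α * t ^ p * ∫ x, {x | t < |u x|}.indicator f x ∂μ := by
    have h1 := (hlow.trans hent).trans hup
    have h2 : ∫ x, ‖H x‖ ^ p ∂μ ≤
        (c / t ^ γ * t * ∫ x, {x | t < |u x|}.indicator f x ∂μ) / β := by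
      rw [le_div_iff₀ hβ0, mul_comm]
      exact h1
    refine h2.trans (le_of_eq ?_)
    -- The factor `t^γ` from the degenerate coercivity cancels the decay `t^(-γ)` of `h`, leaving
    -- `t^(p-1) · t = t^p`.
    have e1 : (3 * t) ^ (p - 1 + γ) = 3 ^ (p - 1 + γ) * (t ^ p / t * t ^ γ) := by
      rw [Real.mul_rpow (by norm_num) ht.le, Real.rpow_add ht, Real.rpow_sub_one ht.ne']
    have e2 : 0 < t ^ γ := by positivity
    rw [hβ, e1]
    field_simp
  have hL : ∫⁻ x, ‖H x‖ₑ ^ p ∂μ = ENNReal.ofReal (∫ x, ‖H x‖ ^ p ∂μ) := by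
    rw [ofReal_integral_eq_lintegral_ofReal hHi (Eventually.of_forall fun x => by positivity)]
    refine lintegral_congr fun x => ?_
    rw [← ENNReal.ofReal_rpow_of_nonneg (norm_nonneg _) (by linarith), ofReal_norm]
  have hR : ∫⁻ x in {x | t < |u x|}, ‖f x‖ₑ ∂μ =
      ENNReal.ofReal (∫ x, {x | t < |u x|}.indicator f x ∂μ) := by
    rw [integral_indicator₀ hset, ofReal_integral_eq_lintegral_ofReal hf.restrict
      (ae_restrict_of_ae hf0)]
    refine lintegral_congr_ae ?_
    filter_upwards [ae_restrict_of_ae hf0] with x hx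
    exact Real.enorm_of_nonneg hx
  rw [hL, hR, ← ENNReal.ofReal_mul (by positivity)]
  exact ENNReal.ofReal_le_ofReal hmain

/-- The Sobolev inequality on a dyadic slice bounds the measure of a superlevel set. -/
lemma rpow_mul_measure_le {p q : ℝ} (hp : 1 < p) (hq : 0 < q) {S : ℝ≥0∞}
    (hS : ∀ (w : E N → ℝ) (G : E N → E N), MemW0With p Ω w G →
      eLpNorm w (ENNReal.ofReal q) (volume.restrict Ω) ≤
        S * eLpNorm G (ENNReal.ofReal p) (volume.restrict Ω))
    {u : E N → ℝ} {v : E N → E N} (hu0 : ∀ᵐ x ∂volume.restrict Ω, 0 ≤ u x)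
    (hW : ∀ k : ℝ, 0 < k →
      MemW0With p Ω (fun x => trunc k (u x)) ({x | |u x| ≤ k}.indicator v))
    {t : ℝ} (ht : 0 < t) :
    ENNReal.ofReal (t ^ p) * volume.restrict Ω {x | 2 * t < |u x|} ^ (p / q) ≤
      S ^ p * ∫⁻ x in Ω, ‖{x | t < |u x| ∧ |u x| ≤ 2 * t}.indicator v x‖ₑ ^ p := by
  have hs := memW0With_slice hp.le hW ht
  have hp0 : 0 < p := by linarith
  -- Chebyshev in `L^q` for the slice function, which equals `t` on `{u > 2t}`; the later power `p /
  -- q` turns `t^q` into `t^p`.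
  have h1 := mul_meas_ge_le_pow_eLpNorm' (volume.restrict Ω) (p := ENNReal.ofReal q)
    (by simpa using hq) ENNReal.ofReal_ne_top hs.1.1 (ENNReal.ofReal t)
  rw [ENNReal.toReal_ofReal hq.le] at h1
  have h2 : volume.restrict Ω {x | 2 * t < |u x|} ≤ volume.restrict Ω
      {x | ENNReal.ofReal t ≤ ‖trunc (2 * t) (u x) - trunc t (u x)‖ₑ} := by
    refine measure_mono_ae ?_
    filter_upwards [hu0] with x hx hx2
    have hx2' : 2 * t < u x := by
      have : 2 * t < |u x| := hx2
      rwa [abs_of_nonneg hx] at this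
    change ENNReal.ofReal t ≤ ‖trunc (2 * t) (u x) - trunc t (u x)‖ₑ
    rw [trunc_of_nonneg (by positivity) hx, trunc_of_nonneg ht hx, min_eq_right hx2'.le,
      min_eq_right (by linarith), show 2 * t - t = t by ring, Real.enorm_of_nonneg ht.le]
  have h3 : ENNReal.ofReal t ^ q * volume.restrict Ω {x | 2 * t < |u x|} ≤
      (S * eLpNorm ({x | t < |u x| ∧ |u x| ≤ 2 * t}.indicator v) (ENNReal.ofReal p)
        (volume.restrict Ω)) ^ q :=
    (mul_le_mul_right h2 _).trans (h1.trans (ENNReal.rpow_le_rpow (hS _ _ hs) hq.le))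
  have h4 := ENNReal.rpow_le_rpow h3 (show 0 ≤ p / q by positivity)
  rw [ENNReal.mul_rpow_of_nonneg _ _ (by positivity), ← ENNReal.rpow_mul, ← ENNReal.rpow_mul,
    mul_div_cancel₀ _ hq.ne', ENNReal.mul_rpow_of_nonneg _ _ hp0.le,
    ENNReal.ofReal_rpow_of_nonneg ht.le hp0.le] at h4
  refine h4.trans (le_of_eq ?_)
  rw [eLpNorm_eq_lintegral_rpow_enorm_toReal (by simpa using hp0) ENNReal.ofReal_ne_top,
    ENNReal.toReal_ofReal hp0.le, ← ENNReal.rpow_mul, one_div_mul_cancel hp0.ne',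
    ENNReal.rpow_one]

/-! ### Superlevel sets and passage to the limit in the truncation level -/

lemma setLIntegral_enorm_le_rpow {X : Type*} [MeasurableSpace X] {μ : Measure X} {f : X → ℝ}
    {r : ℝ} (hr : 1 ≤ r) (hf : AEStronglyMeasurable f μ) (s : Set X) :
    ∫⁻ x in s, ‖f x‖ₑ ∂μ ≤
      eLpNorm f (ENNReal.ofReal r) (μ.restrict s) * μ s ^ (1 - r⁻¹) := by
  have hr' : (1 : ℝ≥0∞) ≤ ENNReal.ofReal r := by simpa using ENNReal.ofReal_le_ofReal hr
  have := eLpNorm_le_eLpNorm_mul_rpow_measure_univ hr' (hf.restrict (s := s))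
  rw [eLpNorm_one_eq_lintegral_enorm, Measure.restrict_apply_univ,
    ENNReal.toReal_ofReal (by linarith)] at this
  simpa using this

/-- The norms of `f` on the superlevel sets `{|u| > t_i}` tend to zero as `t_i → ∞`. -/
lemma tendsto_eLpNorm_restrict_superlevel {X : Type*} [MeasurableSpace X] {μ : Measure X}
    {f u : X → ℝ} {r : ℝ} (hr : 0 < r) (hf : MemLp f (ENNReal.ofReal r) μ)
    (hu : AEMeasurable u μ) {t : ℕ → ℝ} (ht : Tendsto t atTop atTop) :
    Tendsto (fun i => eLpNorm f (ENNReal.ofReal r) (μ.restrict {x | t i < |u x|})) atTop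
      (𝓝 0) := by
  have hset : ∀ i, NullMeasurableSet {x | t i < |u x|} μ := fun i =>
    nullMeasurableSet_lt aemeasurable_const hu.abs
  have := tendsto_eLpNorm_zero_of_dominated hr
    (f := fun i => {x | t i < |u x|}.indicator f) (g := fun x => ‖f x‖)
    (fun i => hf.1.indicator₀ (hset i)) hf.norm
    (fun i => Eventually.of_forall fun x => norm_indicator_le_norm_self _ _)
    (Eventually.of_forall fun x => by
      refine tendsto_const_nhds.congr' ?_
      filter_upwards [ht.eventually_ge_atTop |u x|] with i hi
      rw [Set.indicator_of_notMem (show x ∉ {x | t i < |u x|} from not_lt.2 hi)])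
  refine tendsto_of_tendsto_of_tendsto_of_le_of_le tendsto_const_nhds this
    (fun i => zero_le) (fun i => ?_)
  refine le_trans (le_of_eq (eLpNorm_congr_ae ?_))
    (eLpNorm_mono_measure _ (Measure.restrict_le_self (s := {x | t i < |u x|})))
  filter_upwards [ae_restrict_mem₀ (hset i)] with x hx
  rw [Set.indicator_of_mem (show x ∈ {y | t i < |u y|} from hx)]

/-- Pointwise, `|u|^r ≤ t^r + ∑ (t 2^(i+1))^r 1_{|u| > t 2^i}`, because the dyadic shell containing
`|u x|` already provides a large enough term. The moment of order `r` thus needs the sum with `c =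
2^r`. -/
lemma memLp_of_tsum_superlevel {X : Type*} [MeasurableSpace X] {μ : Measure X}
    [IsFiniteMeasure μ] {u : X → ℝ} (hu : AEMeasurable u μ) {t : ℝ} (ht : 0 < t)
    (hsum : ∀ c : ℝ≥0∞, c ≠ ⊤ → ∑' i : ℕ, c ^ i * μ {x | t * 2 ^ i < |u x|} < ⊤)
    {q : ℝ≥0∞} (hq : q < ⊤) : MemLp u q μ := by
  rcases eq_or_ne q 0 with rfl | hq0
  · exact memLp_zero_iff_aestronglyMeasurable.2 hu.aestronglyMeasurable
  refine ⟨hu.aestronglyMeasurable, ?_⟩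
  rw [eLpNorm_lt_top_iff_lintegral_rpow_enorm_lt_top hq0 hq.ne]
  set r := q.toReal with hr
  have hr0 : 0 < r := ENNReal.toReal_pos hq0 hq.ne
  set s : ℕ → Set X := fun i => {x | t * 2 ^ i < |u x|} with hs
  set A : ℝ≥0∞ := ENNReal.ofReal (t * 2) ^ r with hA
  set c : ℝ≥0∞ := ENNReal.ofReal 2 ^ r with hc
  have hAT : A ≠ ⊤ := ENNReal.rpow_ne_top_of_nonneg hr0.le ENNReal.ofReal_ne_top
  have hcT : c ≠ ⊤ := ENNReal.rpow_ne_top_of_nonneg hr0.le ENNReal.ofReal_ne_top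
  have hAc : ∀ i : ℕ, ENNReal.ofReal (t * 2 ^ (i + 1)) ^ r = A * c ^ i := fun i => by
    rw [show t * 2 ^ (i + 1) = (t * 2) * 2 ^ i by ring, ENNReal.ofReal_mul (by positivity),
      ENNReal.mul_rpow_of_nonneg _ _ hr0.le, ENNReal.ofReal_pow (by norm_num), hc,
      ← ENNReal.rpow_natCast, ← ENNReal.rpow_natCast, ← ENNReal.rpow_mul, ← ENNReal.rpow_mul,
      mul_comm (i : ℝ) r]
  have hset : ∀ i, NullMeasurableSet (s i) μ := fun i =>
    nullMeasurableSet_lt aemeasurable_const hu.abs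
  have hpt : ∀ x, ‖u x‖ₑ ^ r ≤ ENNReal.ofReal t ^ r +
      ∑' i, (s i).indicator (fun _ => A * c ^ i) x := by
    intro x
    have hux : ‖u x‖ₑ = ENNReal.ofReal |u x| := (Real.enorm_eq_ofReal_abs _)
    rcases le_or_gt |u x| t with h | h
    · refine le_trans ?_ le_self_add
      rw [hux]
      gcongr
    · obtain ⟨j, hj1, hj2⟩ := exists_dyadic ht h
      refine le_trans ?_ (le_add_self.trans' (ENNReal.le_tsum j))
      rw [Set.indicator_of_mem (show x ∈ s j from hj1), ← hAc, hux]
      gcongr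
  refine (lintegral_mono hpt).trans_lt ?_
  rw [lintegral_add_left measurable_const, lintegral_const,
    lintegral_tsum fun i => aemeasurable_const.indicator₀ (hset i)]
  refine ENNReal.add_lt_top.2 ⟨ENNReal.mul_lt_top
    (ENNReal.rpow_lt_top_of_nonneg hr0.le ENNReal.ofReal_ne_top) (measure_lt_top _ _), ?_⟩
  have : ∀ i, ∫⁻ x, (s i).indicator (fun _ => A * c ^ i) x ∂μ = A * (c ^ i * μ (s i)) := fun i => by
    rw [lintegral_indicator_const₀ (hset i), mul_assoc]
  simp only [this]
  rw [ENNReal.tsum_mul_left]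
  exact ENNReal.mul_lt_top hAT.lt_top (hsum c hcT)

/-- A function in `L^p` with truncations in `W^{1,p}_0(Ω)` and generalized gradient in `L^p` is
in `W^{1,p}_0(Ω)`. -/
lemma memW0_of_memLp_genGradient [IsFiniteMeasure (volume.restrict Ω)] {p : ℝ} (hp : 1 ≤ p)
    {u : E N → ℝ} {v : E N → E N} (hu : MemLp u (ENNReal.ofReal p) (volume.restrict Ω))
    (hv : MemLp v (ENNReal.ofReal p) (volume.restrict Ω))
    (hW : ∀ k : ℝ, 0 < k →
      MemW0With p Ω (fun x => trunc k (u x)) ({x | |u x| ≤ k}.indicator v)) :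
    MemW0 p Ω u := by
  have hp0 : 0 < p := by linarith
  have hk : ∀ n : ℕ, (0 : ℝ) < (n : ℝ) + 1 := fun n => by positivity
  have hlim : Tendsto (fun n : ℕ => (n : ℝ) + 1) atTop atTop :=
    tendsto_atTop_add_const_right _ _ tendsto_natCast_atTop_atTop
  refine memW0_iff.2 ⟨v, MemW0With.of_tendsto hp hu hv (fun n => hW _ (hk n)) ?_ ?_⟩
  · refine tendsto_eLpNorm_zero_of_dominated hp0 (g := fun x => ‖u x‖ + ‖u x‖)
      (fun n => (hW _ (hk n)).1.1.sub hu.1) (hu.norm.add hu.norm)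
      (fun n => Eventually.of_forall fun x => (norm_sub_le _ _).trans (add_le_add ?_ le_rfl))
      (Eventually.of_forall fun x => ?_)
    · rw [trunc, Real.norm_eq_abs, Real.norm_eq_abs, abs_le]
      have := hk n
      constructor <;> grind
    · refine tendsto_const_nhds.congr' ?_
      filter_upwards [hlim.eventually_ge_atTop |u x|] with n hn
      rw [trunc_of_abs_le hn, sub_self]
  · refine tendsto_eLpNorm_zero_of_dominated hp0 (g := fun x => ‖v x‖ + ‖v x‖)
      (fun n => (hW _ (hk n)).2.2.1.1.sub hv.1) (hv.norm.add hv.norm)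
      (fun n => Eventually.of_forall fun x => (norm_sub_le _ _).trans
        (add_le_add (norm_indicator_le_norm_self _ _) le_rfl))
      (Eventually.of_forall fun x => ?_)
    refine tendsto_const_nhds.congr' ?_
    filter_upwards [hlim.eventually_ge_atTop |u x|] with n hn
    rw [Set.indicator_of_mem (show x ∈ {y | |u y| ≤ (n : ℝ) + 1} from hn), sub_self]

end EntropyDirichlet

/-! ### The main argument -/

open EntropyDirichlet

theorem lemma5p6 {N : ℕ} (hN : 2 ≤ N) (p : ℝ) (hp1 : 1 < p) (hpN : p < N)
    (Ω : Set (EntropyDirichlet.E N)) (hΩ : IsOpen Ω) (hΩb : Bornology.IsBounded Ω)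
    (a : EntropyDirichlet.E N → ℝ → EntropyDirichlet.E N → EntropyDirichlet.E N)
    (ha : EntropyDirichlet.IsCaratheodory Ω a)
    (b : ℝ → ℝ) (hb : Continuous b) (hbb : ∃ B : ℝ, ∀ s, |b s| ≤ B)
    (hcoer : ∀ᵐ x ∂volume.restrict Ω, ∀ (s : ℝ) (ξ : EntropyDirichlet.E N),
      b s * ‖ξ‖ ^ p ≤ inner ℝ (a x s ξ) ξ)
    (α θ γ₂ : ℝ) (hα : 0 < α) (hγ₂ : 0 ≤ γ₂) (hθ : θ = 1 + γ₂ / (p - 1))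
    (hbθ : ∀ s, α / (1 + |s|) ^ (θ * (p - 1)) ≤ b s)
    (h : ℝ → ℝ≥0∞) (hcont : ContinuousOn h (Set.Ioi 0)) (hfin : ∀ s, 0 < s → h s ≠ ⊤)
    (c₂ s₂ : ℝ) (hc₂ : 0 < c₂) (hs₂ : 0 < s₂)
    (hh : ∀ s, s₂ ≤ s → h s ≤ ENNReal.ofReal (c₂ / s ^ γ₂))
    (f : EntropyDirichlet.E N → ℝ) (hf0 : ∀ᵐ x ∂volume.restrict Ω, 0 ≤ f x)
    (hf : MemLp f (ENNReal.ofReal (N / p)) (volume.restrict Ω))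
    (u : EntropyDirichlet.E N → ℝ)
    (hu : EntropyDirichlet.IsEntropySolution p Ω a h f u) :
    EntropyDirichlet.MemW0 p Ω u ∧
      ∀ q : ℝ≥0∞, q < ⊤ → MemLp u q (volume.restrict Ω) := by
  have : IsFiniteMeasure (volume.restrict Ω) :=
    ⟨by rw [Measure.restrict_apply_univ]; exact hΩb.measure_lt_top⟩
  have hp0 : 0 < p := by linarith
  have hN0 : (0 : ℝ) < N := by linarith
  set μ := volume.restrict Ω with hμ
  have hθ' : θ * (p - 1) = p - 1 + γ₂ := by
    rw [hθ, add_mul, one_mul, div_mul_cancel₀ _ (by linarith)]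
  simp only [hθ'] at hbθ
  -- exponents
  set r : ℝ := N / p with hr
  have hr1 : 1 < r := by rwa [hr, one_lt_div hp0]
  set q : ℝ := N * p / (N - p) with hq
  have hNp : 0 < (N : ℝ) - p := by linarith
  have hq0 : 0 < q := by positivity
  have hqp : q⁻¹ = p⁻¹ - (N : ℝ)⁻¹ := by rw [hq]; field_simp
  set κ : ℝ := p / q with hκ
  have hκ0 : 0 < κ := by positivity
  -- The Hölder exponent from `f ∈ L^{N/p}` equals the Sobolev exponent `p / q`; this makes the
  -- recursion linear in `m i ^ κ`.
  have hκr : 1 - r⁻¹ = κ := by rw [hκ, hr, hq]; field_simp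
  have hf1 : Integrable f μ := hf.integrable (by
    simpa using ENNReal.ofReal_le_ofReal hr1.le)
  obtain ⟨v, hv, hW⟩ := exists_isGenGradient hΩ hp1.le hu.nonneg hu.trunc_mem
  obtain ⟨S, hST, hS⟩ := MemW0With.exists_sobolev (Ω := Ω) hp1.le (by omega) hq0 hqp
  -- dyadic levels
  set t₀ : ℝ := max s₂ 1 with ht₀
  -- Levels above `s₂` allow the bound on `h`; levels above `1` give `1 + 2t ≤ 3t`.
  have ht₀1 : 1 ≤ t₀ := le_max_right _ _
  set t : ℕ → ℝ := fun i => t₀ * 2 ^ i with ht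
  have htt₀ : ∀ i, t₀ ≤ t i := fun i =>
    le_mul_of_one_le_right (by linarith) (one_le_pow₀ (by norm_num))
  have htpos : ∀ i, 0 < t i := fun i => by linarith [htt₀ i]
  have httop : Tendsto t atTop atTop :=
    (tendsto_pow_atTop_atTop_of_one_lt (by norm_num : (1 : ℝ) < 2)).const_mul_atTop
      (by linarith)
  have htsucc : ∀ i, t (i + 1) = 2 * t i := fun i => by simp only [ht]; ring
  set K : ℝ := 3 ^ (p - 1 + γ₂) * c₂ / α with hK
  have hK0 : 0 < K := by positivity
  set m : ℕ → ℝ≥0∞ := fun i => μ {x | t i < |u x|} with hm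
  have hmT : ∀ i, m i ≠ ⊤ := fun i => measure_ne_top _ _
  set ε : ℕ → ℝ≥0∞ := fun i => eLpNorm f (ENNReal.ofReal r) (μ.restrict {x | t i < |u x|})
    with hε
  have hεlim : Tendsto ε atTop (𝓝 0) :=
    tendsto_eLpNorm_restrict_superlevel (by linarith) hf hu.aemeasurable httop
  set J : ℕ → ℝ≥0∞ := fun i =>
    ∫⁻ x in Ω, ‖{x | t i < |u x| ∧ |u x| ≤ 2 * t i}.indicator v x‖ₑ ^ p with hJ
  have hJle : ∀ i, J i ≤ ENNReal.ofReal (K * t i ^ p) * (ε i * m i ^ κ) := fun i => by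
    refine (hu.lintegral_slice_le hp1 hcoer hα hγ₂ hbθ hc₂ hh hf0 hf1 hv hW
      (ht₀1.trans (htt₀ i)) ((le_max_left _ _).trans (htt₀ i))).trans ?_
    rw [← hκr]
    gcongr
    exact setLIntegral_enorm_le_rpow hr1.le hf.1 _
  set δ : ℕ → ℝ≥0∞ := fun i => S ^ p * ENNReal.ofReal K * ε i with hδ
  have hSp : S ^ p * ENNReal.ofReal K ≠ ⊤ := ENNReal.mul_ne_top
    (ENNReal.rpow_ne_top_of_nonneg hp0.le hST) ENNReal.ofReal_ne_top
  have hδlim : Tendsto δ atTop (𝓝 0) := by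
    simpa using ENNReal.Tendsto.const_mul (a := S ^ p * ENNReal.ofReal K) hεlim (Or.inr hSp)
  -- Sobolev and energy estimates carry the same factor `t i ^ p`, which cancels; only `δ i`, a
  -- multiple of the tail norm of `f`, remains.
  have hrec : ∀ i, m (i + 1) ^ κ ≤ δ i * m i ^ κ := fun i => by
    have h1 := rpow_mul_measure_le hp1 hq0 hS hu.nonneg hW (htpos i)
    rw [← htsucc] at h1
    have h2 : ENNReal.ofReal (t i ^ p) * m (i + 1) ^ κ ≤
        ENNReal.ofReal (t i ^ p) * (δ i * m i ^ κ) := by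
      refine h1.trans ?_
      rw [htsucc]
      calc S ^ p * J i ≤ S ^ p * (ENNReal.ofReal (K * t i ^ p) * (ε i * m i ^ κ)) := by
            gcongr
            exact hJle i
        _ = _ := by
            rw [ENNReal.ofReal_mul hK0.le]
            ring
    have hpos : 0 < t i ^ p := Real.rpow_pos_of_pos (htpos i) p
    rwa [ENNReal.mul_le_mul_iff_right (by simpa using hpos) ENNReal.ofReal_ne_top] at h2
  have hrec' : ∀ i, m (i + 1) ≤ δ i ^ κ⁻¹ * m i := fun i => by
    have := ENNReal.rpow_le_rpow (hrec i) (inv_nonneg.2 hκ0.le)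
    rwa [ENNReal.mul_rpow_of_nonneg _ _ (inv_nonneg.2 hκ0.le), ← ENNReal.rpow_mul,
      ← ENNReal.rpow_mul, mul_inv_cancel₀ hκ0.ne', ENNReal.rpow_one, ENNReal.rpow_one] at this
  have hδlim' : Tendsto (fun i => δ i ^ κ⁻¹) atTop (𝓝 0) := by
    have := (ENNReal.continuous_rpow_const (y := κ⁻¹)).tendsto 0 |>.comp hδlim
    rwa [ENNReal.zero_rpow_of_pos (inv_pos.2 hκ0)] at this
  have hLq : ∀ q : ℝ≥0∞, q < ⊤ → MemLp u q μ := fun q hq =>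
    memLp_of_tsum_superlevel hu.aemeasurable (by linarith)
      (fun c hc => tsum_pow_mul_lt_top hmT hrec' hδlim' hc) hq
  refine ⟨memW0_of_memLp_genGradient hp1.le (hLq _ ENNReal.ofReal_lt_top) ?_ hW, hLq⟩
  -- integrability of the gradient
  refine ⟨hv.1.aestronglyMeasurable, ?_⟩
  rw [eLpNorm_lt_top_iff_lintegral_rpow_enorm_lt_top (by simpa using hp0) ENNReal.ofReal_ne_top,
    ENNReal.toReal_ofReal hp0.le]
  set G₀ := {x | |u x| ≤ t₀}.indicator v with hG₀
  have hG₀m : MemLp G₀ (ENNReal.ofReal p) μ := (hW t₀ (by linarith)).2.2.1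
  have hslice : ∀ i, MemLp ({x | t i < |u x| ∧ |u x| ≤ 2 * t i}.indicator v)
      (ENNReal.ofReal p) μ := fun i => (memW0With_slice hp1.le hW (htpos i)).2.2.1
  have hpt : ∀ x, ‖v x‖ₑ ^ p ≤ ‖G₀ x‖ₑ ^ p +
      ∑' i, ‖{x | t i < |u x| ∧ |u x| ≤ 2 * t i}.indicator v x‖ₑ ^ p := by
    intro x
    rcases le_or_gt |u x| t₀ with hx | hx
    · refine le_trans (le_of_eq ?_) le_self_add
      rw [hG₀, Set.indicator_of_mem (show x ∈ {x | |u x| ≤ t₀} from hx)]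
    · obtain ⟨j, hj1, hj2⟩ := exists_dyadic (by linarith) hx
      refine le_trans (le_of_eq ?_) (le_add_self.trans' (ENNReal.le_tsum j))
      rw [Set.indicator_of_mem]
      exact ⟨hj1, (htsucc j) ▸ hj2⟩
  refine (lintegral_mono hpt).trans_lt ?_
  rw [lintegral_add_left' (hG₀m.1.enorm.pow_const p),
    lintegral_tsum fun i => (hslice i).1.enorm.pow_const p]
  refine ENNReal.add_lt_top.2 ⟨?_, ?_⟩
  · have := lintegral_rpow_enorm_lt_top_of_eLpNorm_lt_top (by simpa using hp0)
      ENNReal.ofReal_ne_top hG₀m.2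
    rwa [ENNReal.toReal_ofReal hp0.le] at this
  · set F : ℝ≥0∞ := eLpNorm f (ENNReal.ofReal r) μ with hF
    set c : ℝ≥0∞ := ENNReal.ofReal (2 ^ p) with hc
    -- Here the tail norm of `f` is just bounded by the full norm: the decay of `m i ^ κ` already
    -- beats the growth `(2^p)^i` of `t i ^ p`.
    have hJ' : ∀ i, J i ≤ ENNReal.ofReal (K * t₀ ^ p) * F * (c ^ i * m i ^ κ) := fun i => by
      refine (hJle i).trans ?_
      have e1 : K * t i ^ p = K * t₀ ^ p * (2 ^ p) ^ i := by
        simp only [ht]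
        rw [Real.mul_rpow (by linarith) (by positivity), ← Real.rpow_natCast,
          ← Real.rpow_natCast, ← Real.rpow_mul (by norm_num), ← Real.rpow_mul (by norm_num),
          mul_comm (i : ℝ) p]
        ring
      rw [e1, ENNReal.ofReal_mul (by positivity), ENNReal.ofReal_pow (by positivity)]
      have hεF : ε i ≤ F := eLpNorm_mono_measure _ Measure.restrict_le_self
      calc ENNReal.ofReal (K * t₀ ^ p) * c ^ i * (ε i * m i ^ κ)
          ≤ ENNReal.ofReal (K * t₀ ^ p) * c ^ i * (F * m i ^ κ) := by gcongr
        _ = _ := by ring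
    refine (ENNReal.tsum_le_tsum hJ').trans_lt ?_
    rw [ENNReal.tsum_mul_left]
    refine ENNReal.mul_lt_top (ENNReal.mul_lt_top ENNReal.ofReal_lt_top hf.2) ?_
    exact tsum_pow_mul_lt_top (fun i => ENNReal.rpow_ne_top_of_nonneg hκ0.le (hmT i)) hrec
      hδlim ENNReal.ofReal_ne_top
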